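/- Consider ten points labelled $1,\dots,10$ and the eleven triples $$\{1,5,10\},\{3,5,8\},\{4,5,7\},\{2,5,9\},\{1,3,7\},\{4,8,10\},\{1,2,8\},\{3,9,10\},\{1,4,6\},\{2,3,6\},\{6,7,9\}.$$ A realization over a field $K$, in the affine or in the projective plane over $K$, is an assignment of distinct points to the labels such that three distinct points are collinear if and only if their labels form one of the listed triples. A point of the real projective plane is rational if it has rational homogeneous coordinates. 1. There are eleven different listed triples, and any two of them share at most one point. In every real realization, affine or projective, no four points are collinear. 2. The configuration has a realization in the affine plane $\mathbb{R}^2$. 3. Every realization in $\mathbb{R}^2$ contains a point with an irrational coordinate, and every realization in the real projective plane contains a point that is not rational. 4. Let $K$ be a field of characteristic $0$. For every realization in the projective plane over $K$ there is a projectivity over $K$ that sends the points $4,10,7,1$ to $(1,1),(1,-1),(-1,1),(-1,-1)$ respectively and the points $8$ and $3$ to $(1,a)$ and $(-1,a)$ for some $a\in K$ with $a\neq\pm1$, and there is $y\in K$ such that $(x,y)=(-a,y)$ lies on the curve $2y^2=x^3+x^2-x+1$. In particular, a rational realization would give a rational point of this curve with $x\neq\pm1$. 5. The only $(x,y)\in\mathbb{Q}^2$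 with $2y^2=x^3+x^2-x+1$ are $(\pm1,\pm1)$ (all four choices of signs). 6. The curve $2y^2=x^3+x^2-x+1$ is birationally equivalent over $\mathbb{Q}$ to $y^2+y=x^3-x^2$, which is a model over $\mathbb{Q}$ of the modular curve $X_1(11)$: after removal of the point at infinity and finitely many other points (the common zeros of the curve with one polynomial $h\in\mathbb{Q}[x,y]$), the points of the curve $y^2+y=x^3-x^2$ over every field $K$ of characteristic $0$ are in bijection, compatibly with homomorphisms of fields, with the isomorphism classes over $K$ of pairs $(E,P)$, where $E$ is an elliptic curve over $K$ and $P\in E(K)$ has exact order $11$. The only $(x,y)\in\mathbb{Q}^2$ with $y^2+y=x^3-x^2$ are $(0,0),(0,-1),(1,0),(1,-1)$. -/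

import Mathlib

open Polynomial
open scoped LinearAlgebra.Projectivization Polynomial.Bivariate

/-! ### Point-line arrangements -/

/-- The eleven collinear triples of the ten-point configuration. The points are labelled
`1, …, 9, 10` by the elements of `Fin 10`, where the label `10` is the element `0`. -/
def elkiesTriples : Finset (Finset (Fin 10)) :=
  {{1, 5, 0}, {3, 5, 8}, {4, 5, 7}, {2, 5, 9}, {1, 3, 7}, {4, 8, 0}, {1, 2, 8}, {3, 9, 0},
    {1, 4, 6}, {2, 3, 6}, {6, 7, 9}}

/-- `p` realizes the set `T` of triples in the affine plane over `K`: the points are distinct, and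
the triples of points that are collinear are precisely those listed in `T`. -/
def IsAffineRealization {K ι : Type*} [Field K] [DecidableEq ι] (T : Finset (Finset ι))
    (p : ι → Fin 2 → K) : Prop :=
  Function.Injective p ∧
    ∀ i j k, i ≠ j → i ≠ k → j ≠ k →
      (Collinear K ({p i, p j, p k} : Set (Fin 2 → K)) ↔ ({i, j, k} : Finset ι) ∈ T)

/-- Points of the projective plane are collinear if they all lie on a line `a x + b y + c z = 0`;
the line is given by the point `ℓ = [a : b : c]` of the dual plane. -/
def ProjectivelyCollinear {K : Type*} [Field K] (s : Set (ℙ K (Fin 3 → K))) : Prop :=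
  ∃ ℓ : ℙ K (Fin 3 → K), ∀ P ∈ s, ℓ.orthogonal P

/-- `q` realizes the set `T` of triples in the projective plane over `K`. -/
def IsProjectiveRealization {K ι : Type*} [Field K] [DecidableEq ι] (T : Finset (Finset ι))
    (q : ι → ℙ K (Fin 3 → K)) : Prop :=
  Function.Injective q ∧
    ∀ i j k, i ≠ j → i ≠ k → j ≠ k →
      (ProjectivelyCollinear {q i, q j, q k} ↔ ({i, j, k} : Finset ι) ∈ T)

/-- A point of the real projective plane is rational if it has rational homogeneous coordinates. -/
def IsRationalPoint (P : ℙ ℝ (Fin 3 → ℝ)) : Prop :=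
  ∃ (v : Fin 3 → ℚ) (hv : (fun t => (v t : ℝ)) ≠ 0), P = Projectivization.mk ℝ _ hv

/-- The point `(x, y) = [x : y : 1]` of the affine part of the projective plane. -/
def affinePoint {K : Type*} [Field K] (x y : K) : ℙ K (Fin 3 → K) :=
  Projectivization.mk K ![x, y, 1] (fun h => one_ne_zero (congrFun h 2))

/-- The action on points of the plane-to-plane projectivity given by an invertible linear map. -/
def projectivity {K : Type*} [Field K] (S : (Fin 3 → K) ≃ₗ[K] (Fin 3 → K)) :
    ℙ K (Fin 3 → K) → ℙ K (Fin 3 → K) :=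
  Projectivization.map (S : (Fin 3 → K) →ₗ[K] (Fin 3 → K)) S.injective

/-! ### Plane curves over `ℚ` -/

/-- The polynomial of the plane curve `2 y² = x³ + x² - x + 1`. -/
noncomputable def elkiesCubic : ℚ[X][Y] := 2 * Y ^ 2 - C (X ^ 3 + X ^ 2 - X + 1)

/-- The polynomial of the plane curve `y² + y = x³ - x²`. -/
noncomputable def weierstrassCubic : ℚ[X][Y] := Y ^ 2 + Y - C (X ^ 3 - X ^ 2)

/-- The irreducible plane curves `f = 0` and `g = 0` are birationally equivalent over `ℚ`: the
fraction fields of their coordinate rings are isomorphic over `ℚ`. -/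
def BirationallyEquivalent (f g : ℚ[X][Y]) : Prop :=
  Irreducible f ∧ Irreducible g ∧
    Nonempty (FractionRing (AdjoinRoot f) ≃ₐ[ℚ] FractionRing (AdjoinRoot g))

/-- The value `f(x, y)` of a polynomial with rational coefficients at a point over a field of
characteristic zero. -/
noncomputable def evalAt {K : Type*} [Field K] [CharZero K] (f : ℚ[X][Y]) (x y : K) : K :=
  (f.map (mapRingHom (algebraMap ℚ K))).evalEval x y

/-! ### The modular curve `X₁(N)` -/

/-- An elliptic curve over `K` in Weierstrass form, together with an affine `K`-rational point
`(x, y)` of exact order `N`. -/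
structure TorsionPair (N : ℕ) (K : Type*) [Field K] [DecidableEq K] where
  W : WeierstrassCurve K
  elliptic : W.IsElliptic
  x : K
  y : K
  nonsingular : W.toAffine.Nonsingular x y
  order : addOrderOf (WeierstrassCurve.Affine.Point.some x y nonsingular) = N

/-- Isomorphism over `K` of pairs `(E, P)`: an admissible change of Weierstrass coordinates
`x = u² x' + r`, `y = u³ y' + u² s x' + t` taking the first curve and point to the second. -/
def TorsionPair.Iso {N : ℕ} {K : Type*} [Field K] [DecidableEq K] (A B : TorsionPair N K) : Prop :=
  ∃ c : WeierstrassCurve.VariableChange K, c • A.W = B.W ∧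
    A.x = (c.u : K) ^ 2 * B.x + c.r ∧
    A.y = (c.u : K) ^ 3 * B.y + (c.u : K) ^ 2 * c.s * B.x + c.t

/-- The pair `B` over `L` is the base change of the pair `A` over `K` along `σ : K → L`. -/
def TorsionPair.IsBaseChange {N : ℕ} {K L : Type*} [Field K] [DecidableEq K] [Field L]
    [DecidableEq L] (σ : K →+* L) (A : TorsionPair N K) (B : TorsionPair N L) : Prop :=
  B.W = A.W.map σ ∧ B.x = σ A.x ∧ B.y = σ A.y

/-- The irreducible plane curve `f = 0` is a model over `ℚ` of the modular curve `X₁(N)`, for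
`N ≥ 4`. By definition `X₁(N)` is the smooth completion of the curve `Y₁(N)` whose points over a
field `K` are the isomorphism classes over `K` of pairs `(E, P)`, with `E` an elliptic curve over
`K` and `P` a `K`-rational point of exact order `N`. So we ask that, after removal of the finitely
many points with `h = 0`, the points of the curve over every field `K` of characteristic zero are
in bijection with these isomorphism classes, compatibly with all homomorphisms of fields. -/
def IsModelOfX1.{u} (N : ℕ) (f : ℚ[X][Y]) : Prop :=
  Irreducible f ∧
  ∃ (h : ℚ[X][Y])
    (Φ : ∀ (K : Type u) [Field K] [CharZero K] [DecidableEq K], TorsionPair N K → K × K),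
    ¬ f ∣ h ∧
    (∀ (K : Type u) [Field K] [CharZero K] [DecidableEq K],
      (∀ A B : TorsionPair N K, Φ K A = Φ K B ↔ A.Iso B) ∧
      (∀ x y : K, (∃ A : TorsionPair N K, Φ K A = (x, y)) ↔
        evalAt f x y = 0 ∧ evalAt h x y ≠ 0)) ∧
    (∀ (K L : Type u) [Field K] [CharZero K] [DecidableEq K] [Field L] [CharZero L]
      [DecidableEq L] (σ : K →+* L) (A : TorsionPair N K) (B : TorsionPair N L),
      A.IsBaseChange σ B → Φ L B = (σ (Φ K A).1, σ (Φ K A).2))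

/-! Rational points. Completing the square turns `y² + y = x³ - x²` into `r² = 4x³ - 4x² + 1`. Let
`K = ℚ(π)` with `π³ + 2π² = 2`. For `T = 2x` the equation reads `2r² = T³ - 2T² + 2 = N(T + π)`,
which calls for a 2-descent over `K`. The discriminant bound 44 makes the ring of integers of `K`
principal, and its units modulo squares are generated by `-1` and `1 + π`. Factorization, the sign
of norms and a parity obstruction then show that `2(T + π)` is a square (`trib_two_mul_eq_sq`).
Comparing the coordinates of this square with respect to `1, π, π²` yields a rational point whose
double has x-coordinate `x` (`exists_halving`). Away from `x = 0, 1` doubling strictly increases the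
naive height (`Rat.naiveHeight_lt_of_halving`), so infinite descent leaves only these two values.
The substitution `x ↦ 2x - 1`, `y ↦ 2y + 1` carries the result over to `2y² = x³ + x² - x + 1` and
gives the birational equivalence.

Modular curve. A pair `(E, P)` with `P` of order 11 has a unique Tate normal form `y² + (1 - c)xy -
by = x³ - bx²` with `P = (0, 0)`. Put `b = rc` and `c = s(r - 1)`. Then `11P = 0` means `x(5P) =
x(6P)`, that is, `r(s - 1)³ = (r - 1)(r - s)`, and `v = r - 1`, `u = (r - 1)/(s - 1)` turn this into
`v² + v = u³ - u²`. The excluded points are those where the parameters degenerate or the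
discriminant vanishes.

Configuration. The points 4, 10, 7, 1 are in general position and can be moved to the vertices of a
square. The other incidences leave one parameter `a` and a quadratic equation over the ground field;
its having a root puts `(-a, y)` on the cubic (`exists_of_det₃_square`). Rational points of the
cubic have `a = ±1`, which is degenerate, so there is no realization over `ℚ`. The value `a = 0`
gives a realization over `ℚ(√2)`. -/

/-! ### The cubic field of discriminant `-44` -/

/-- The Eisenstein polynomial `x³ + 2x² - 2`, of discriminant `-44`. -/
noncomputable def tribPoly : ℤ[X] := X ^ 3 + C 2 * X ^ 2 - C 2

theorem tribPoly_natDegree : tribPoly.natDegree = 3 := by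
  unfold tribPoly; compute_degree!

theorem tribPoly_monic : tribPoly.Monic := by
  unfold tribPoly; monicity!

theorem tribPoly_isEisensteinAt : tribPoly.IsEisensteinAt (Ideal.span {(2 : ℤ)}) where
  leading := by
    rw [tribPoly_monic.leadingCoeff, Ideal.mem_span_singleton]; norm_num
  mem := by
    intro n hn
    rw [tribPoly_natDegree] at hn
    rw [Ideal.mem_span_singleton]
    unfold tribPoly
    interval_cases n <;> simp [coeff_X_pow]
  notMem := by
    unfold tribPoly
    rw [Ideal.span_singleton_pow, Ideal.mem_span_singleton]
    simp [coeff_X_pow]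

theorem tribPoly_irreducible : Irreducible tribPoly :=
  tribPoly_isEisensteinAt.irreducible
    ((Ideal.span_singleton_prime two_ne_zero).2 Int.prime_two)
    tribPoly_monic.isPrimitive (by rw [tribPoly_natDegree]; norm_num)

theorem tribPoly_map_irreducible : Irreducible (tribPoly.map (algebraMap ℤ ℚ)) :=
  (tribPoly_monic.irreducible_iff_irreducible_map_fraction_map).1 tribPoly_irreducible

theorem aeval_tribPoly {R : Type*} [CommRing R] (x : R) :
    aeval x tribPoly = x ^ 3 + 2 * x ^ 2 - 2 := by
  simp only [tribPoly, map_sub, map_add, map_mul, map_pow, aeval_X, map_ofNat]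

/-- There is a number field generated by a root of `x³ + 2x² - 2`. -/
theorem exists_tribField : ∃ (K : Type) (_ : Field K) (_ : NumberField K) (B : PowerBasis ℚ K),
    B.dim = 3 ∧ B.gen ^ 3 = 2 - 2 * B.gen ^ 2 := by
  have : Fact (Irreducible (tribPoly.map (algebraMap ℤ ℚ))) := ⟨tribPoly_map_irreducible⟩
  let K := AdjoinRoot (tribPoly.map (algebraMap ℤ ℚ))
  let B₀ : PowerBasis ℚ K := AdjoinRoot.powerBasis tribPoly_map_irreducible.ne_zero
  have hd : B₀.dim = 3 := by
    rw [AdjoinRoot.powerBasis_dim, natDegree_map_eq_of_injective (algebraMap ℤ ℚ).injective_int,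
      tribPoly_natDegree]
  have hg : B₀.gen ^ 3 = 2 - 2 * B₀.gen ^ 2 := by
    have h : AdjoinRoot.mk (tribPoly.map (algebraMap ℤ ℚ)) (tribPoly.map (algebraMap ℤ ℚ)) = 0 :=
      AdjoinRoot.mk_self
    conv at h => enter [1, 2]; rw [tribPoly]
    simp only [Polynomial.map_sub, Polynomial.map_add, Polynomial.map_mul, Polynomial.map_pow,
      Polynomial.map_C, map_X, map_sub, map_add, map_mul, map_pow, AdjoinRoot.mk_X] at h
    have h2 : AdjoinRoot.mk (tribPoly.map (algebraMap ℤ ℚ)) (C (algebraMap ℤ ℚ 2)) = 2 := by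
      rw [map_ofNat, map_ofNat, map_ofNat]
    rw [h2] at h
    rw [AdjoinRoot.powerBasis_gen]
    linear_combination h
  have : CharZero K := algebraRat.charZero K
  have e : Subsingleton (Algebra ℚ K) := inferInstance
  exact ⟨K, inferInstance, { to_finiteDimensional := B₀.finite }, B₀, hd, hg⟩

section TribField

variable {K : Type*} [Field K] [NumberField K] {B : PowerBasis ℚ K}

theorem trib_isIntegral (hg : B.gen ^ 3 = 2 - 2 * B.gen ^ 2) : IsIntegral ℤ B.gen :=
  ⟨tribPoly, tribPoly_monic, by
    rw [← aeval_def, aeval_tribPoly]; linear_combination hg⟩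

theorem trib_minpoly_int (hg : B.gen ^ 3 = 2 - 2 * B.gen ^ 2) : minpoly ℤ B.gen = tribPoly := by
  have hdvd : minpoly ℤ B.gen ∣ tribPoly :=
    minpoly.isIntegrallyClosed_dvd (trib_isIntegral hg) (by
      rw [aeval_tribPoly]; linear_combination hg)
  exact eq_of_monic_of_associated (minpoly.monic (trib_isIntegral hg)) tribPoly_monic
    (((minpoly.prime_of_isIntegrallyClosed (trib_isIntegral hg)).irreducible.associated_of_dvd
      tribPoly_irreducible hdvd))

theorem trib_minpoly_rat (hg : B.gen ^ 3 = 2 - 2 * B.gen ^ 2) :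
    minpoly ℚ B.gen = tribPoly.map (algebraMap ℤ ℚ) := by
  rw [minpoly.isIntegrallyClosed_eq_field_fractions' ℚ (trib_isIntegral hg), trib_minpoly_int hg]

/-- The basis `1, π, π²`. -/
noncomputable def tribBasis (B : PowerBasis ℚ K) (hd : B.dim = 3) : Module.Basis (Fin 3) ℚ K :=
  B.basis.reindex (finCongr hd)

theorem tribBasis_apply (hd : B.dim = 3) (i : Fin 3) : tribBasis B hd i = B.gen ^ (i : ℕ) := by
  simp [tribBasis]

theorem trib_coords_eq_zero (hd : B.dim = 3) {a b c : ℚ}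
    (h : (a : K) + b * B.gen + c * B.gen ^ 2 = 0) : a = 0 ∧ b = 0 ∧ c = 0 := by
  have := Fintype.linearIndependent_iff.1 (tribBasis B hd).linearIndependent ![a, b, c]
    (by simpa [Fin.sum_univ_three, tribBasis_apply, Algebra.smul_def] using h)
  exact ⟨this 0, this 1, this 2⟩

theorem trib_exists_coords (hd : B.dim = 3) (z : K) :
    ∃ a b c : ℚ, z = a + b * B.gen + c * B.gen ^ 2 := by
  refine ⟨(tribBasis B hd).repr z 0, (tribBasis B hd).repr z 1, (tribBasis B hd).repr z 2, ?_⟩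
  conv_lhs => rw [← (tribBasis B hd).sum_repr z]
  simp [Fin.sum_univ_three, tribBasis_apply, Algebra.smul_def]

theorem trib_leftMulMatrix (hd : B.dim = 3) (hg : B.gen ^ 3 = 2 - 2 * B.gen ^ 2) :
    Algebra.leftMulMatrix (tribBasis B hd) B.gen = !![0, 0, 2; 1, 0, 0; 0, 1, -2] := by
  have h0 : B.gen * tribBasis B hd 0 = tribBasis B hd 1 := by simp [tribBasis_apply]
  have h1 : B.gen * tribBasis B hd 1 = tribBasis B hd 2 := by simp [tribBasis_apply]; ring
  have h2 : B.gen * tribBasis B hd 2 = (2 : ℚ) • tribBasis B hd 0 - (2 : ℚ) • tribBasis B hd 2 := by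
    simp [tribBasis_apply, Algebra.smul_def]; linear_combination hg
  ext i j
  rw [Algebra.leftMulMatrix_eq_repr_mul]
  fin_cases j
  · simp [h0]; fin_cases i <;> simp
  · simp [h1]; fin_cases i <;> simp
  · simp [h2]; fin_cases i <;> simp

/-- The determinant of multiplication by the element. For `c = 0` it is `a³ - 2a²b + 2b³`, the
homogenised cubic of the descent. -/
theorem trib_norm (hd : B.dim = 3) (hg : B.gen ^ 3 = 2 - 2 * B.gen ^ 2) (a b c : ℚ) :
    Algebra.norm ℚ ((a : K) + b * B.gen + c * B.gen ^ 2) =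
    a ^ 3 + 2 * b ^ 3 + 4 * c ^ 3 - 2 * a ^ 2 * b + 4 * a ^ 2 * c  + 8 * a * c ^ 2
      - 6 * a * b * c - 4 * b ^ 2 * c := by
  have hq : ∀ q : ℚ, (q : K) = algebraMap ℚ K q := fun q => rfl
  rw [Algebra.norm_eq_matrix_det (tribBasis B hd), map_add, map_add, map_mul, map_mul, map_pow,
    trib_leftMulMatrix hd hg, hq, hq, hq, AlgHom.commutes, AlgHom.commutes, AlgHom.commutes]
  simp [Matrix.det_fin_three, Matrix.algebraMap_eq_diagonal, pow_two, Matrix.mul_apply,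
    Fin.sum_univ_three]
  ring

theorem trib_discr_basis (hd : B.dim = 3) (hg : B.gen ^ 3 = 2 - 2 * B.gen ^ 2) :
    Algebra.discr ℚ B.basis = -44 := by
  rw [Algebra.discr_powerBasis_eq_norm, trib_minpoly_rat hg, B.finrank, hd]
  -- The coordinates `0, 4, 3` are those of the derivative `3π² + 4π` of the minimal polynomial at
  -- `π`.
  have h := trib_norm hd hg 0 4 3
  have e : aeval B.gen (derivative (tribPoly.map (algebraMap ℤ ℚ))) =
    ((0 : ℚ) : K) + (4 : ℚ) * B.gen + (3 : ℚ) * B.gen ^ 2 := by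
    rw [derivative_map, aeval_map_algebraMap, tribPoly]
    simp only [derivative_C_mul, derivative_X_pow, derivative_C,
      map_sub, map_add, map_mul, map_pow, aeval_X, aeval_C, map_zero, map_natCast]
    push_cast
    simp only [map_ofNat]
    ring
  rw [e, h]
  norm_num

/-- The discriminant `-44` multiplies integers into `ℤ[π]`, and the Eisenstein property at 2 removes
the factor 4. The remaining factor 11 is odd, so it does no harm to the parity arguments below. -/
theorem trib_exists_int_coords (hd : B.dim = 3) (hg : B.gen ^ 3 = 2 - 2 * B.gen ^ 2) {z : K}
    (hz : IsIntegral ℤ z) :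
    ∃ a b c : ℤ, 11 * z = a + b * B.gen + c * B.gen ^ 2 := by
  have h1 := Algebra.discr_mul_isIntegral_mem_adjoin ℚ (trib_isIntegral hg) hz
  rw [trib_discr_basis hd hg] at h1
  have h2 : (11 : K) * z ∈ Algebra.adjoin ℤ {B.gen} := by
    refine mem_adjoin_of_smul_prime_pow_smul_of_minpoly_isEisensteinAt (K := ℚ) (n := 2)
      Int.prime_two (trib_isIntegral hg) (by simpa using (isIntegral_algebraMap (R := ℤ) (x := 11)).mul hz) ?_ ?_
    · have := neg_mem h1
      convert this using 1
      simp [Algebra.smul_def]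
      ring
    · rw [trib_minpoly_int hg]; exact tribPoly_isEisensteinAt
  obtain ⟨p, hp⟩ := Algebra.adjoin_singleton_eq_range_aeval ℤ B.gen ▸ h2
  have h3 : aeval B.gen (p %ₘ tribPoly) = 11 * z := by
    rw [← hp]
    conv_rhs => rw [← modByMonic_add_div p tribPoly]
    have h0 : aeval B.gen tribPoly = 0 := by rw [← trib_minpoly_int hg]; exact minpoly.aeval _ _
    simp [h0]
  have h4 : (p %ₘ tribPoly).natDegree < 3 := by
    rw [← tribPoly_natDegree]
    exact natDegree_modByMonic_lt _ tribPoly_monic (fun h => by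
      simpa [h] using tribPoly_natDegree)
  refine ⟨(p %ₘ tribPoly).coeff 0, (p %ₘ tribPoly).coeff 1, (p %ₘ tribPoly).coeff 2, ?_⟩
  rw [← h3, aeval_eq_sum_range' h4]
  simp [Finset.sum_range_succ, zsmul_eq_mul]

end TribField

/-! ### Square classes in a unique factorization domain -/

theorem exists_squarefree_mul_sq {R : Type*} [CommRing R] [IsDomain R]
    [UniqueFactorizationMonoid R] {a : R} (ha : a ≠ 0) :
    ∃ r s : R, Squarefree r ∧ a = r * s ^ 2 := by
  induction a using UniqueFactorizationMonoid.induction_on_prime with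
  | h₁ => exact absurd rfl ha
  | h₂ x hx => exact ⟨x, 1, hx.squarefree, by simp⟩
  | h₃ x p hx hp ih =>
    obtain ⟨r, s, hr, rfl⟩ := ih hx
    by_cases hpr : p ∣ r
    · obtain ⟨r', rfl⟩ := hpr
      exact ⟨r', p * s, hr.of_mul_right, by ring⟩
    · exact ⟨p * r, s, squarefree_mul_iff.mpr
        ⟨hp.irreducible.isRelPrime_iff_not_dvd.mpr hpr, hp.squarefree, hr⟩, by ring⟩

/-- The equation makes the valuation of `r` at `q` even, and it is positive. -/
theorem sq_dvd_of_mul_eq_mul_sq {R : Type*} [CommRing R] [IsDomain R]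
    [UniqueFactorizationMonoid R] {q r s d k z : R} (hq : Prime q) (hr : q ∣ r) (hd : ¬ q ∣ d)
    (hk : ¬ q ∣ k) (hz : z ≠ 0) (h : r * s ^ 2 * d = k * z ^ 2) : q ^ 2 ∣ r := by
  have hk0 : k ≠ 0 := fun h0 => hk (h0 ▸ dvd_zero q)
  have hne : r * s ^ 2 * d ≠ 0 := h ▸ mul_ne_zero hk0 (pow_ne_zero 2 hz)
  have hr0 : r ≠ 0 := fun h0 => hne (by rw [h0]; ring)
  have hs0 : s ≠ 0 := fun h0 => hne (by rw [h0]; ring)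
  have h1 := congrArg (emultiplicity q) h
  rw [emultiplicity_mul hq, emultiplicity_mul hq, emultiplicity_mul hq, emultiplicity_pow hq,
    emultiplicity_pow hq, emultiplicity_eq_zero.2 hd, emultiplicity_eq_zero.2 hk,
    (FiniteMultiplicity.of_prime_left hq hr0).emultiplicity_eq_multiplicity,
    (FiniteMultiplicity.of_prime_left hq hs0).emultiplicity_eq_multiplicity,
    (FiniteMultiplicity.of_prime_left hq hz).emultiplicity_eq_multiplicity] at h1
  have h2 : multiplicity q r + 2 * multiplicity q s = 2 * multiplicity q z := by
    norm_cast at h1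
    simpa using h1
  have h3 : 1 ≤ multiplicity q r :=
    (FiniteMultiplicity.of_prime_left hq hr0).le_multiplicity_of_pow_dvd (by simpa)
  exact pow_dvd_of_le_multiplicity (by omega)

/-! ### Class number one, and units modulo squares -/

section TribField

variable {K : Type*} [Field K] [NumberField K] {B : PowerBasis ℚ K}

open NumberField

/-- Here `d` is the determinant of the integral matrix that expresses the powers of `π` in an
integral basis. -/
theorem trib_discr (hd : B.dim = 3) (hg : B.gen ^ 3 = 2 - 2 * B.gen ^ 2) :
    ∃ d : ℤ, d ^ 2 * discr K = -44 := by
  let e : Module.Free.ChooseBasisIndex ℤ (𝓞 K) ≃ Fin B.dim :=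
    (integralBasis K).indexEquiv B.basis
  let b := (integralBasis K).reindex e
  have hint : ∀ j, ∃ w : 𝓞 K, algebraMap (𝓞 K) K w = B.basis j := fun j =>
    ⟨⟨B.gen ^ (j : ℕ), (trib_isIntegral hg).pow _⟩, by rw [B.coe_basis]; rfl⟩
  choose w hw using hint
  let P : Matrix (Fin B.dim) (Fin B.dim) ℤ :=
    fun i j => (RingOfIntegers.basis K).repr (w j) (e.symm i)
  have hP : P.map (algebraMap ℤ ℚ) = b.toMatrix B.basis := by
    ext i j
    simp only [P, b, Module.Basis.toMatrix_apply, Module.Basis.repr_reindex_apply, ← hw,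
      integralBasis_repr_apply]
    rfl
  refine ⟨P.det, ?_⟩
  have h1 := Algebra.discr_of_matrix_vecMul (A := ℚ) (b : Fin B.dim → K) (P.map (algebraMap ℤ ℚ))
  rw [hP, Module.Basis.toMatrix_map_vecMul, trib_discr_basis hd hg, ← hP] at h1
  have h2 : Algebra.discr ℚ b = discr K := by
    rw [Module.Basis.coe_reindex, Algebra.discr_reindex, coe_discr]
  have h3 : (P.map (algebraMap ℤ ℚ)).det = (P.det : ℚ) := ((algebraMap ℤ ℚ).map_det P).symm
  rw [h2, h3] at h1
  exact_mod_cast h1.symm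

theorem trib_discr_neg (hd : B.dim = 3) (hg : B.gen ^ 3 = 2 - 2 * B.gen ^ 2) : discr K < 0 := by
  obtain ⟨d, h⟩ := trib_discr hd hg
  nlinarith [sq_nonneg d]

theorem trib_abs_discr_le (hd : B.dim = 3) (hg : B.gen ^ 3 = 2 - 2 * B.gen ^ 2) :
    |discr K| ≤ 44 := by
  obtain ⟨d, h⟩ := trib_discr hd hg
  rw [abs_of_neg (trib_discr_neg hd hg)]
  have : 0 < d ^ 2 := by
    rcases eq_or_ne d 0 with rfl | h0
    · norm_num at h
    · positivity
  nlinarith [trib_discr_neg hd hg]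

theorem trib_finrank (hd : B.dim = 3) : Module.finrank ℚ K = 3 := by rw [B.finrank, hd]

/-- The sign of the discriminant is `(-1)` to the number of complex places, and a cubic field has at
most one. -/
theorem trib_nrComplexPlaces (hd : B.dim = 3) (hg : B.gen ^ 3 = 2 - 2 * B.gen ^ 2) :
    InfinitePlace.nrComplexPlaces K = 1 := by
  have h1 := InfinitePlace.card_add_two_mul_card_eq_rank K
  have h2 := sign_discr K
  rw [Int.sign_eq_neg_one_of_neg (trib_discr_neg hd hg)] at h2
  rw [trib_finrank hd] at h1
  have : InfinitePlace.nrComplexPlaces K ≤ 1 := by omega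
  interval_cases h : InfinitePlace.nrComplexPlaces K
  · norm_num at h2
  · rfl

theorem trib_rank (hd : B.dim = 3) (hg : B.gen ^ 3 = 2 - 2 * B.gen ^ 2) : Units.rank K = 1 := by
  have h1 := InfinitePlace.card_add_two_mul_card_eq_rank K
  rw [trib_finrank hd, trib_nrComplexPlaces hd hg] at h1
  have h2 := trib_nrComplexPlaces hd hg
  rw [Units.rank, InfinitePlace.card_eq_nrRealPlaces_add_nrComplexPlaces]
  omega

/-- Minkowski's bound: the discriminant is at most 44 in absolute value, below `(2 · (3.14/4) ·
27/6)² ≈ 49.9`, where 3.14 is a lower bound for the circle constant. -/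
theorem trib_isPrincipalIdealRing (hd : B.dim = 3) (hg : B.gen ^ 3 = 2 - 2 * B.gen ^ 2) :
    IsPrincipalIdealRing (𝓞 K) := by
  apply RingOfIntegers.isPrincipalIdealRing_of_abs_discr_lt
  rw [trib_finrank hd, trib_nrComplexPlaces hd hg]
  have h : ((|discr K| : ℤ) : ℝ) ≤ 44 := by exact_mod_cast trib_abs_discr_le hd hg
  refine lt_of_le_of_lt h ?_
  have := Real.pi_gt_d2
  norm_num [Nat.factorial]
  nlinarith

/-- In coordinates, a square has an even middle coordinate. -/
theorem trib_sq_coords (hd : B.dim = 3) (hg : B.gen ^ 3 = 2 - 2 * B.gen ^ 2) {z : K}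
    (hz : IsIntegral ℤ z) : ∃ p q r : ℤ, Even q ∧
      121 * z ^ 2 = p + q * B.gen + r * B.gen ^ 2 := by
  obtain ⟨a, b, c, h⟩ := trib_exists_int_coords hd hg hz
  refine ⟨a ^ 2 + 4 * b * c - 4 * c ^ 2, 2 * (a * b + c ^ 2),
    b ^ 2 + 2 * a * c - 4 * b * c + 4 * c ^ 2, even_two_mul _, ?_⟩
  push_cast
  linear_combination (11 * z + a + b * B.gen + c * B.gen ^ 2) * h +
    (2 * b * c + c ^ 2 * B.gen - 2 * c ^ 2) * hg

theorem trib_coords_eq (hd : B.dim = 3) {a b c a' b' c' : ℤ}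
    (h : (a : K) + b * B.gen + c * B.gen ^ 2 = a' + b' * B.gen + c' * B.gen ^ 2) :
    a = a' ∧ b = b' ∧ c = c' := by
  obtain ⟨h1, h2, h3⟩ := trib_coords_eq_zero hd (a := a - a') (b := b - b') (c := c - c')
    (by push_cast; linear_combination h)
  exact ⟨by exact_mod_cast sub_eq_zero.1 h1, by exact_mod_cast sub_eq_zero.1 h2,
    by exact_mod_cast sub_eq_zero.1 h3⟩

/-- The ring element `π`. -/
noncomputable def tribPi (hg : B.gen ^ 3 = 2 - 2 * B.gen ^ 2) : 𝓞 K := ⟨B.gen, trib_isIntegral hg⟩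

theorem coe_tribPi (hg : B.gen ^ 3 = 2 - 2 * B.gen ^ 2) : (tribPi hg : K) = B.gen := rfl

theorem tribPi_cube (hg : B.gen ^ 3 = 2 - 2 * B.gen ^ 2) :
    tribPi hg ^ 3 = 2 - 2 * tribPi hg ^ 2 :=
  RingOfIntegers.ext hg

/-- The unit `1 + π`. -/
noncomputable def tribUnit (hg : B.gen ^ 3 = 2 - 2 * B.gen ^ 2) : (𝓞 K)ˣ where
  val := 1 + tribPi hg
  inv := (1 - tribPi hg) * (1 + tribPi hg) ^ 2
  val_inv := by linear_combination -tribPi hg * tribPi_cube hg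
  inv_val := by linear_combination -tribPi hg * tribPi_cube hg

theorem trib_norm_int (hd : B.dim = 3) (hg : B.gen ^ 3 = 2 - 2 * B.gen ^ 2) (a b c : ℤ) :
    Algebra.norm ℤ ((a : 𝓞 K) + b * tribPi hg + c * tribPi hg ^ 2) =
    a ^ 3 + 2 * b ^ 3 + 4 * c ^ 3 - 2 * a ^ 2 * b + 4 * a ^ 2 * c  + 8 * a * c ^ 2
      - 6 * a * b * c - 4 * b ^ 2 * c := by
  have h := trib_norm hd hg a b c
  rw [← Int.cast_inj (α := ℚ), Algebra.coe_norm_int]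
  push_cast [coe_tribPi]
  push_cast at h
  exact h

/-- The middle coordinate of `±121(1 + π)` is odd, contrary to `trib_sq_coords`. -/
theorem tribUnit_not_sq (hd : B.dim = 3) (hg : B.gen ^ 3 = 2 - 2 * B.gen ^ 2) (v : (𝓞 K)ˣ) :
    tribUnit hg ≠ v ^ 2 ∧ tribUnit hg ≠ - v ^ 2 := by
  obtain ⟨p, q, r, hq, h⟩ := trib_sq_coords hd hg (z := ((v : 𝓞 K) : K)) (v : 𝓞 K).2
  constructor <;> intro h1 <;>
    have h2 := congrArg (fun u : (𝓞 K)ˣ => ((u : 𝓞 K) : K)) h1 <;>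
    simp [tribUnit, coe_tribPi] at h2
  · have := (trib_coords_eq hd (a := 121) (b := 121) (c := 0) (a' := p) (b' := q) (c' := r)
      (by push_cast; linear_combination 121 * h2 + h)).2.1
    rw [← this] at hq
    exact absurd hq (by decide)
  · have := (trib_coords_eq hd (a := -121) (b := -121) (c := 0) (a' := p) (b' := q) (c' := r)
      (by push_cast; linear_combination -121 * h2 + h)).2.1
    rw [← this] at hq
    exact absurd hq (by decide)

/-- The unit rank is 1 and the only roots of unity are `±1`. It need not be known that `1 + π` is
fundamental: it is enough that it is, up to sign, an odd power of a fundamental unit. -/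
theorem trib_unit_eq (hd : B.dim = 3) (hg : B.gen ^ 3 = 2 - 2 * B.gen ^ 2) (u : (𝓞 K)ˣ) :
    ∃ v : (𝓞 K)ˣ, u = v ^ 2 ∨ u = -v ^ 2 ∨ u = tribUnit hg * v ^ 2 ∨ u = -(tribUnit hg * v ^ 2) := by
  have hr := trib_rank hd hg
  have hodd : Odd (Module.finrank ℚ K) := by rw [trib_finrank hd]; decide
  obtain ⟨η, hη⟩ : ∃ η : (𝓞 K)ˣ, ∀ u : (𝓞 K)ˣ, ∃ n : ℤ, u = η ^ n ∨ u = - η ^ n := by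
    refine ⟨Units.fundSystem K ⟨0, by omega⟩, fun u => ?_⟩
    obtain ⟨⟨ζ, e⟩, h, -⟩ := Units.exist_unique_eq_mul_prod K u
    have : Unique (Fin (Units.rank K)) := by rw [hr]; infer_instance
    refine ⟨e ⟨0, by omega⟩, ?_⟩
    rw [Fintype.prod_unique] at h
    have h0 : (default : Fin (Units.rank K)) = ⟨0, by omega⟩ := Subsingleton.elim _ _
    rw [h0] at h
    rcases Units.torsion_eq_one_or_neg_one_of_odd_finrank hodd ζ with h1 | h1
    · left; rw [h]; simp [h1]
    · right; rw [h]; simp [h1]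
  obtain ⟨k, hk⟩ := hη (tribUnit hg)
  have hkodd : Odd k := by
    by_contra hcon
    obtain ⟨m, rfl⟩ := Int.not_odd_iff_even.1 hcon
    have := tribUnit_not_sq hd hg (η ^ m)
    rw [← two_mul, mul_comm, zpow_mul] at hk
    rcases hk with hk | hk
    · exact this.1 (by exact_mod_cast hk)
    · exact this.2 (by exact_mod_cast hk)
  obtain ⟨j, rfl⟩ := hkodd
  obtain ⟨n, hn⟩ := hη u
  rcases Int.even_or_odd' n with ⟨m, rfl | rfl⟩
  · have hsq : η ^ (2 * m) = (η ^ m) ^ 2 := by rw [mul_comm, zpow_mul]; norm_cast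
    rw [hsq] at hn
    exact ⟨η ^ m, by tauto⟩
  · have hsq : η ^ (2 * m + 1) = η ^ (2 * j + 1) * (η ^ (m - j)) ^ 2 := by
      rw [← zpow_natCast, ← zpow_mul, ← zpow_add]; congr 1; push_cast; ring
    rw [hsq] at hn
    refine ⟨η ^ (m - j), ?_⟩
    rcases hk with hk | hk <;> rcases hn with hn | hn <;> simp [hk, hn]

end TribField

theorem Int.eq_zero_of_sq_eq_mul_sq {k : ℕ} (hk : ¬ IsSquare k) {x y : ℤ}
    (h : x ^ 2 = k * y ^ 2) : x = 0 := by
  by_contra hx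
  have hy : (y : ℚ) ≠ 0 := by
    rintro h0
    have : y = 0 := by exact_mod_cast h0
    rw [this] at h
    exact hx (by simpa using h)
  apply hk
  rw [← Rat.isSquare_natCast_iff]
  refine ⟨x / y, ?_⟩
  field_simp
  exact_mod_cast h.symm

/-! ### The class of `a + bπ` modulo squares -/

section TribField

variable {K : Type*} [Field K] [NumberField K] {B : PowerBasis ℚ K}

open NumberField

/-- The prime `3 + 4π + 2π²` of norm `11`. -/
noncomputable def tribRho (hg : B.gen ^ 3 = 2 - 2 * B.gen ^ 2) : 𝓞 K :=
  3 + 4 * tribPi hg + 2 * tribPi hg ^ 2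

theorem trib_norm_tribPi (hd : B.dim = 3) (hg : B.gen ^ 3 = 2 - 2 * B.gen ^ 2) :
    Algebra.norm ℤ (tribPi hg) = 2 := by
  have h := trib_norm_int hd hg 0 1 0
  norm_num at h
  exact h

theorem trib_norm_tribRho (hd : B.dim = 3) (hg : B.gen ^ 3 = 2 - 2 * B.gen ^ 2) :
    Algebra.norm ℤ (tribRho hg) = 11 := by
  have h := trib_norm_int hd hg 3 4 2
  norm_num at h
  exact h

theorem trib_norm_tribUnit (hd : B.dim = 3) (hg : B.gen ^ 3 = 2 - 2 * B.gen ^ 2) :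
    Algebra.norm ℤ (tribUnit hg : 𝓞 K) = 1 := by
  have h := trib_norm_int hd hg 1 1 0
  norm_num at h
  exact h

theorem trib_norm_neg (hd : B.dim = 3) (x : 𝓞 K) : Algebra.norm ℤ (-x) = -Algebra.norm ℤ x := by
  have h : Algebra.norm ℤ (-1 : 𝓞 K) = -1 := by
    have := Algebra.norm_algebraMap (R := ℤ) (S := 𝓞 K) (-1 : ℤ)
    rw [RingOfIntegers.rank, trib_finrank hd] at this
    simpa using this
  rw [← neg_one_mul, map_mul, h, neg_one_mul]

theorem NumberField.RingOfIntegers.prime_of_prime_norm [IsPrincipalIdealRing (𝓞 K)] {x : 𝓞 K}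
    (h : Prime (Algebra.norm ℤ x)) : Prime x := by
  have hunit : ∀ y : 𝓞 K, IsUnit (Algebra.norm ℤ y) → IsUnit y := fun y hy => by
    rw [NumberField.isUnit_iff_norm, RingOfIntegers.coe_norm, ← Algebra.coe_norm_int]
    exact_mod_cast Int.isUnit_iff_abs_eq.1 hy
  refine Irreducible.prime ⟨fun hx => h.not_isUnit (hx.map _), fun y z hyz => ?_⟩
  rw [hyz, map_mul] at h
  exact (h.irreducible.isUnit_or_isUnit rfl).imp (hunit y) (hunit z)

/-- A prime that divides both `a + bπ` and its cofactor in the norm divides `b² f'(π)`, where `f'(π)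
= π²ρ` is the derivative of the minimal polynomial at `π`. By coprimality of `a` and `b` it is then
`π` or `ρ` up to a unit. All other primes, being prime to `k` as well, occur in `a + bπ` to an even
power. -/
theorem trib_associated_mul_sq (hd : B.dim = 3) (hg : B.gen ^ 3 = 2 - 2 * B.gen ^ 2) {a b : ℤ}
    (hab : IsCoprime a b) {k z : ℤ} (hk : k ∣ 2)
    (h : a ^ 3 - 2 * a ^ 2 * b + 2 * b ^ 3 = k * z ^ 2) (hz : z ≠ 0) :
    ∃ (u : (𝓞 K)ˣ) (s : 𝓞 K) (i j : ℕ), i ≤ 1 ∧ j ≤ 1 ∧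
      (a : 𝓞 K) + b * tribPi hg = u * tribPi hg ^ i * tribRho hg ^ j * s ^ 2 := by
  have := trib_isPrincipalIdealRing hd hg
  set π := tribPi hg with hπ
  set ρ := tribRho hg with hρ
  have hπ3 : π ^ 3 = 2 - 2 * π ^ 2 := tribPi_cube hg
  have hρ' : ρ = 3 + 4 * π + 2 * π ^ 2 := rfl
  have hprimeπ : Prime π := RingOfIntegers.prime_of_prime_norm (by
    rw [hπ, trib_norm_tribPi hd hg]; exact Int.prime_two)
  have hprimeρ : Prime ρ := RingOfIntegers.prime_of_prime_norm (by
    rw [hρ, trib_norm_tribRho hd hg]; exact Int.prime_iff_natAbs_prime.2 (by norm_num))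
  have hπρ : ¬ Associated π ρ := fun hass => by
    have := hass.map (Algebra.norm ℤ)
    rw [hπ, hρ, trib_norm_tribPi hd hg, trib_norm_tribRho hd hg, Int.associated_iff] at this
    omega
  set α : 𝓞 K := a + b * π with hα
  -- The cofactor of `α` in its norm, written so that its residue `b²π²ρ` modulo `α` is visible.
  set β : 𝓞 K := b ^ 2 * π ^ 2 * ρ + α * (a - 2 * b * (1 + π)) with hβ
  have hαβ : α * β = (k : 𝓞 K) * (z : 𝓞 K) ^ 2 := by
    have h' : (a : 𝓞 K) ^ 3 - 2 * a ^ 2 * b + 2 * b ^ 3 = k * z ^ 2 := by exact_mod_cast h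
    rw [← h', hβ, hα, hρ']
    linear_combination (2 * (a + b * π) * b ^ 2 * π + b ^ 3) * hπ3
  have hz' : (z : 𝓞 K) ≠ 0 := by exact_mod_cast hz
  have hk' : (k : 𝓞 K) ∣ 2 := by
    obtain ⟨c, hc⟩ := hk
    exact ⟨c, by exact_mod_cast hc⟩
  have hk0 : (k : 𝓞 K) ≠ 0 := fun h0 => by rw [h0, zero_dvd_iff] at hk'; exact two_ne_zero hk'
  have hα0 : α ≠ 0 := fun h0 => by
    rw [h0, zero_mul] at hαβ
    exact mul_ne_zero hk0 (pow_ne_zero 2 hz') hαβ.symm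
  obtain ⟨r, s, hr, hrs⟩ := exists_squarefree_mul_sq hα0
  have key : ∀ q : 𝓞 K, Prime q → q ∣ r → Associated q π ∨ Associated q ρ := by
    intro q hq hqr
    by_contra! hcon
    have hnπ : ¬ q ∣ π := fun hdvd =>
      hcon.1 (hq.irreducible.associated_of_dvd hprimeπ.irreducible hdvd)
    have hnρ : ¬ q ∣ ρ := fun hdvd =>
      hcon.2 (hq.irreducible.associated_of_dvd hprimeρ.irreducible hdvd)
    have hqα : q ∣ α := hrs ▸ hqr.mul_right _
    have hqβ : ¬ q ∣ β := by
      intro hqβ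
      have h1 : q ∣ b ^ 2 * π ^ 2 * ρ := by
        have := dvd_sub hqβ (hqα.mul_right (a - 2 * b * (1 + π)))
        rwa [hβ, add_sub_cancel_right] at this
      have h2 : q ∣ b := by
        rcases hq.dvd_or_dvd h1 with h1 | h1
        · rcases hq.dvd_or_dvd h1 with h1 | h1
          · exact hq.dvd_of_dvd_pow h1
          · exact absurd (hq.dvd_of_dvd_pow h1) hnπ
        · exact absurd h1 hnρ
      have h3 : q ∣ a := by
        have := dvd_sub hqα (h2.mul_right π)
        rwa [hα, add_sub_cancel_right] at this
      obtain ⟨x, y, hxy⟩ := hab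
      have hxy' : (x : 𝓞 K) * a + y * b = 1 := by exact_mod_cast hxy
      exact hq.not_dvd_one (hxy' ▸ dvd_add (h3.mul_left _) (h2.mul_left _))
    have hqk : ¬ q ∣ (k : 𝓞 K) := by
      intro hqk
      -- Every prime above 2 is associated with `π`.
      have h3 : π ^ 3 = 2 * (1 - π ^ 2) := by linear_combination hπ3
      exact hnπ (hq.dvd_of_dvd_pow (h3 ▸ (hqk.trans hk').mul_right _))
    have h2 := sq_dvd_of_mul_eq_mul_sq hq hqr hqβ hqk hz' (hrs ▸ hαβ)
    exact hq.not_isUnit (hr q (by rwa [← pow_two]))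
  obtain ⟨i, r₁, hi, hr₁, hnr₁⟩ : ∃ (i : ℕ) (r₁ : 𝓞 K), i ≤ 1 ∧ r = π ^ i * r₁ ∧ ¬ π ∣ r₁ := by
    by_cases hdvd : π ∣ r
    · obtain ⟨r₁, hr₁⟩ := hdvd
      refine ⟨1, r₁, le_rfl, by simpa using hr₁, fun ⟨c, hc⟩ => hprimeπ.not_isUnit (hr π ⟨c, ?_⟩)⟩
      rw [hr₁, hc, mul_assoc]
    · exact ⟨0, r, by simp, by simp, hdvd⟩
  obtain ⟨j, r₂, hj, hr₂, hnr₂⟩ : ∃ (j : ℕ) (r₂ : 𝓞 K), j ≤ 1 ∧ r₁ = ρ ^ j * r₂ ∧ ¬ ρ ∣ r₂ := by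
    by_cases hdvd : ρ ∣ r₁
    · obtain ⟨r₂, hr₂⟩ := hdvd
      refine ⟨1, r₂, le_rfl, by simpa using hr₂, fun ⟨c, hc⟩ =>
        hprimeρ.not_isUnit (hr ρ ⟨π ^ i * c, ?_⟩)⟩
      rw [hr₁, hr₂, hc]; ring
    · exact ⟨0, r₁, by simp, by simp, hdvd⟩
  have hr0 : r₂ ≠ 0 := fun h0 => hα0 (by rw [hrs, hr₁, hr₂, h0]; ring)
  have hu : IsUnit r₂ := by
    by_contra hnu
    obtain ⟨q, hq, hqd⟩ := WfDvdMonoid.exists_irreducible_factor hnu hr0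
    rcases key q hq.prime (by rw [hr₁, hr₂]; exact (hqd.mul_left _).mul_left _) with h1 | h1
    · exact hnr₁ (by rw [hr₂]; exact (h1.symm.dvd.trans hqd).mul_left _)
    · exact hnr₂ (h1.symm.dvd.trans hqd)
  refine ⟨hu.unit, s, i, j, hi, hj, ?_⟩
  rw [hrs, hr₁, hr₂, IsUnit.unit_spec]
  ring

/-- Taking norms fixes what the factorization left open. Positivity gives `u` the norm 1, which
excludes the negative unit classes because the degree is odd. Since 2, 11 and 22 are not squares,
`ρ` is absent and the exponent of `π` is determined by `k`. -/
theorem trib_eq_sq (hd : B.dim = 3) (hg : B.gen ^ 3 = 2 - 2 * B.gen ^ 2) {a b : ℤ}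
    (hab : IsCoprime a b) {k z : ℤ} (hk : k = 1 ∨ k = 2)
    (h : a ^ 3 - 2 * a ^ 2 * b + 2 * b ^ 3 = k * z ^ 2) (hz : z ≠ 0) :
    ∃ (e i : ℕ) (s : 𝓞 K), e ≤ 1 ∧ k = 2 ^ i ∧
      (a : 𝓞 K) + b * tribPi hg = tribUnit hg ^ e * tribPi hg ^ i * s ^ 2 := by
  obtain ⟨u, s, i, j, hi, hj, hα⟩ := trib_associated_mul_sq hd hg hab
    (by rcases hk with rfl | rfl <;> norm_num) h hz
  have hN := congrArg (Algebra.norm ℤ) hα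
  have hN1 := trib_norm_int hd hg a b 0
  simp only [Int.cast_zero, zero_mul, add_zero] at hN1
  rw [hN1] at hN
  simp only [map_mul, map_pow, trib_norm_tribPi hd hg, trib_norm_tribRho hd hg] at hN
  have hN2 : (k : ℤ) * z ^ 2 = Algebra.norm ℤ (u : 𝓞 K) * 2 ^ i * 11 ^ j *
      Algebra.norm ℤ s ^ 2 := by
    rw [← h, ← hN]; ring
  have hkpos : 0 < k := by rcases hk with rfl | rfl <;> norm_num
  have hLpos : 0 < k * z ^ 2 := by positivity
  have hu1 : Algebra.norm ℤ (u : 𝓞 K) = 1 := by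
    rcases Int.isUnit_iff.1 (u.isUnit.map (Algebra.norm ℤ)) with h1 | h1
    · exact h1
    · rw [h1] at hN2
      have : 0 ≤ (2 : ℤ) ^ i * 11 ^ j * Algebra.norm ℤ s ^ 2 := by positivity
      linarith
  rw [hu1] at hN2
  obtain ⟨hki, rfl⟩ : k = 2 ^ i ∧ j = 0 := by
    by_contra hcon
    apply hz
    set n := Algebra.norm ℤ s
    have h2z : 2 * z = 0 → z = 0 := fun h => by omega
    have hns : ∀ m ∈ ({2, 11, 22} : Finset ℕ), ¬ IsSquare m := by
      rintro m hm ⟨r, rfl⟩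
      simp only [Finset.mem_insert, Finset.mem_singleton] at hm
      have : r ≤ 4 := by
        by_contra! hr
        have := Nat.mul_le_mul hr hr
        omega
      interval_cases r <;> omega
    interval_cases i <;> interval_cases j <;> rcases hk with rfl | rfl <;>
      simp only [pow_zero, pow_one, one_mul, mul_one] at hN2
    all_goals first
      | exact absurd ⟨rfl, rfl⟩ hcon
      | exact Int.eq_zero_of_sq_eq_mul_sq (k := 2) (hns _ (by simp)) (y := n) (by push_cast; linarith)
      | exact Int.eq_zero_of_sq_eq_mul_sq (k := 11) (hns _ (by simp)) (y := n) (by push_cast; linarith)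
      | exact Int.eq_zero_of_sq_eq_mul_sq (k := 22) (hns _ (by simp)) (y := n) (by push_cast; linarith)
      | exact h2z (Int.eq_zero_of_sq_eq_mul_sq (k := 2) (hns _ (by simp)) (y := n)
          (by push_cast; linarith))
      | exact h2z (Int.eq_zero_of_sq_eq_mul_sq (k := 22) (hns _ (by simp)) (y := n)
          (by push_cast; linarith))
  obtain ⟨e, v, he, hv⟩ : ∃ (e : ℕ) (v : (𝓞 K)ˣ), e ≤ 1 ∧ u = tribUnit hg ^ e * v ^ 2 := by
    obtain ⟨v, hv⟩ := trib_unit_eq hd hg u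
    have hneg : ∀ w : (𝓞 K)ˣ, Algebra.norm ℤ (w : 𝓞 K) = 1 → u ≠ -w := fun w hw huw => by
      rw [huw, Units.val_neg, trib_norm_neg hd, hw] at hu1
      norm_num at hu1
    have hvv : Algebra.norm ℤ ((v ^ 2 : (𝓞 K)ˣ) : 𝓞 K) = 1 := by
      rw [Units.val_pow_eq_pow_val, map_pow]
      rcases Int.isUnit_iff.1 (v.isUnit.map (Algebra.norm ℤ)) with h1 | h1 <;> rw [h1] <;> rfl
    rcases hv with hv | hv | hv | hv
    · exact ⟨0, v, by simp, by simpa using hv⟩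
    · exact absurd hv (hneg _ hvv)
    · exact ⟨1, v, by simp, by simpa using hv⟩
    · exact absurd hv (hneg _ (by
        rw [Units.val_mul, map_mul, trib_norm_tribUnit hd hg, hvv, one_mul]))
  refine ⟨e, i, v * s, he, hki, ?_⟩
  rw [hα, hv]
  push_cast
  ring

/-- If `(a : b)` is a rational point with `b (a³ - 2a²b + 2b³)` twice a square, then
`2b (a + bπ)` is a square. -/
theorem trib_two_mul_eq_sq (hd : B.dim = 3) (hg : B.gen ^ 3 = 2 - 2 * B.gen ^ 2) {a b : ℤ}
    (hab : IsCoprime a b) (hb : 0 < b) {z : ℤ} (hz : z ≠ 0)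
    (h : b * (a ^ 3 - 2 * a ^ 2 * b + 2 * b ^ 3) = 2 * z ^ 2) :
    ∃ s : K, 2 * b * (a + b * B.gen) = s ^ 2 := by
  have hcop : IsCoprime b (a ^ 3 - 2 * a ^ 2 * b + 2 * b ^ 3) := by
    have h1 := (hab.symm.pow_right (n := 3)).add_mul_left_right (-2 * a ^ 2 + 2 * b ^ 2)
    have h2 : a ^ 3 - 2 * a ^ 2 * b + 2 * b ^ 3 = a ^ 3 + b * (-2 * a ^ 2 + 2 * b ^ 2) := by ring
    rwa [h2]
  -- In particular 2 and `π` have the same class modulo squares.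
  have hpi : (2 : K) = (1 + B.gen) ^ 2 * B.gen ^ 3 := by
    linear_combination -(B.gen ^ 2 + 1) * hg
  have hz2 : 0 < z ^ 2 := by positivity
  have hF : 0 < a ^ 3 - 2 * a ^ 2 * b + 2 * b ^ 3 := by
    by_contra! hcon
    nlinarith
  have sq_of : ∀ {x y w : ℤ}, 0 < x → IsCoprime x y → x * y = w ^ 2 → ∃ v, x = v ^ 2 := by
    intro x y w hx hxy h
    obtain ⟨v, hv | hv⟩ := Int.sq_of_isCoprime hxy h
    · exact ⟨v, hv⟩
    · nlinarith [sq_nonneg v]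
  -- Both factors are squares once the single factor 2 is assigned: to `b` if `b` is even, to the
  -- cubic form if `b` is odd.
  rcases Int.even_or_odd' b with ⟨c, hc | hc⟩
  · have hcF : c * (a ^ 3 - 2 * a ^ 2 * b + 2 * b ^ 3) = z ^ 2 := by
      have : 2 * (c * (a ^ 3 - 2 * a ^ 2 * b + 2 * b ^ 3)) = 2 * z ^ 2 := by
        rw [← h]; nth_rewrite 3 [hc]; ring
      linarith
    have hccop : IsCoprime c (a ^ 3 - 2 * a ^ 2 * b + 2 * b ^ 3) :=
      hcop.of_isCoprime_of_dvd_left ⟨2, by rw [hc]; ring⟩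
    obtain ⟨β, hβ⟩ := sq_of (by omega) hccop hcF
    obtain ⟨γ, hγ⟩ := sq_of hF hccop.symm (by rw [mul_comm, hcF])
    have hγ0 : γ ≠ 0 := by rintro rfl; simp at hγ; omega
    obtain ⟨e, i, s, he, hi, hs⟩ := trib_eq_sq hd hg hab (k := 1) (Or.inl rfl)
      (by rw [hγ, one_mul]) hγ0
    obtain rfl : i = 0 := by
      rcases i with _ | i
      · rfl
      · exfalso; rw [pow_succ] at hi; omega
    have hsK : (a : K) + b * B.gen = (1 + B.gen) ^ e * (s : K) ^ 2 := by
      have := congrArg (algebraMap (𝓞 K) K) hs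
      simpa [tribUnit, coe_tribPi] using this
    interval_cases e
    · refine ⟨2 * β * s, ?_⟩
      rw [hsK, hc, hβ]; push_cast; ring
    -- With the factor `1 + π`, evenness of `q` and of `b` makes `p`, and then `a`, even. This
    -- contradicts coprimality.
    · exfalso
      obtain ⟨p, q, r, hq, hsq⟩ := trib_sq_coords hd hg s.isIntegral_coe
      have h1 := trib_coords_eq hd (a := 121 * a) (b := 121 * b) (c := 0)
        (a' := p + 2 * r) (b' := p + q) (c' := q - r) (by
          push_cast
          linear_combination 121 * hsK + (1 + B.gen) * hsq + r * hg)
      have ha : Odd a := by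
        rw [← Int.not_even_iff_odd]
        intro hae
        have := hab.isUnit_of_dvd' hae.two_dvd ⟨c, hc⟩
        norm_num [Int.isUnit_iff] at this
      obtain ⟨a', rfl⟩ := ha
      obtain ⟨q', rfl⟩ := hq
      omega
  · obtain ⟨f, hf⟩ : (2 : ℤ) ∣ a ^ 3 - 2 * a ^ 2 * b + 2 * b ^ 3 := by
      refine (Int.prime_two.dvd_or_dvd ⟨_, h⟩).resolve_left ?_
      omega
    have hcF : b * f = z ^ 2 := by rw [hf] at h; linarith
    have hbf : IsCoprime b f := hcop.of_isCoprime_of_dvd_right ⟨2, by rw [hf]; ring⟩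
    obtain ⟨β, hβ⟩ := sq_of hb hbf hcF
    obtain ⟨γ, hγ⟩ := sq_of (by omega) hbf.symm (by rw [mul_comm, hcF])
    have hγ0 : γ ≠ 0 := by rintro rfl; simp at hγ; omega
    obtain ⟨e, i, s, he, hi, hs⟩ := trib_eq_sq hd hg hab (k := 2) (Or.inr rfl)
      (by rw [hf, hγ]) hγ0
    obtain rfl : i = 1 := by
      rcases i with _ | _ | i
      · norm_num at hi
      · rfl
      · exfalso
        have : (0 : ℤ) < 2 ^ i := by positivity
        rw [pow_succ, pow_succ] at hi; omega
    have hsK : (a : K) + b * B.gen = (1 + B.gen) ^ e * B.gen * (s : K) ^ 2 := by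
      have := congrArg (algebraMap (𝓞 K) K) hs
      simpa [tribUnit, coe_tribPi] using this
    interval_cases e
    · refine ⟨β * (1 + B.gen) * B.gen ^ 2 * s, ?_⟩
      rw [hsK, hpi, hβ]; push_cast; ring
    -- With the factor `(1 + π)π`, the vanishing of the last coordinate makes `p` even, and then `b`
    -- is even.
    · exfalso
      obtain ⟨p, q, r, hq, hsq⟩ := trib_sq_coords hd hg s.isIntegral_coe
      have h1 := trib_coords_eq hd (a := 121 * a) (b := 121 * b) (c := 0)
        (a' := 2 * (q - r)) (b' := p + 2 * r) (c' := p + q - 2 * (q - r)) (by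
          push_cast
          linear_combination 121 * hsK + (1 + B.gen) * B.gen * hsq + (q - r + r * B.gen) * hg)
      obtain ⟨q', rfl⟩ := hq
      omega

end TribField

/-! ### Rational points -/

/-- Every rational point of `r² = 4x³ - 4x² + 1` is the double of another one. -/
theorem exists_halving {x r : ℚ} (h : r ^ 2 = 4 * x ^ 3 - 4 * x ^ 2 + 1) :
    ∃ x' r' : ℚ, r' ^ 2 = 4 * x' ^ 3 - 4 * x' ^ 2 + 1 ∧
      x * (4 * x' ^ 3 - 4 * x' ^ 2 + 1) = x' ^ 4 - 2 * x' + 1 := by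
  obtain ⟨K, _, _, B, hd, hg⟩ := exists_tribField
  set T : ℚ := 2 * x with hT
  have hr0 : r ≠ 0 := by
    rintro rfl
    have hN := trib_norm hd hg T 1 0
    have h0 : T ^ 3 + 2 * 1 ^ 3 + 4 * 0 ^ 3 - 2 * T ^ 2 * 1 + 4 * T ^ 2 * 0 + 8 * T * 0 ^ 2
      - 6 * T * 1 * 0 - 4 * 1 ^ 2 * 0 = 0 := by rw [hT]; linear_combination -2 * h
    rw [h0, Algebra.norm_eq_zero_iff] at hN
    exact one_ne_zero (trib_coords_eq_zero hd hN).2.1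
  have hb : (0 : ℤ) < T.den := by exact_mod_cast T.den_pos
  have hb' : (T.den : ℚ) ≠ 0 := by exact_mod_cast T.den_ne_zero
  have hTnd : (T.num : ℚ) = T * T.den := (Rat.mul_den_eq_num T).symm
  have hab : IsCoprime T.num (T.den : ℤ) := Int.isCoprime_iff_gcd_eq_one.2 T.reduced
  have hz : (T.den : ℚ) * (T.num ^ 3 - 2 * T.num ^ 2 * T.den + 2 * T.den ^ 3) =
      2 * (r * T.den ^ 2) ^ 2 := by
    rw [hTnd, mul_pow r, h, hT]; ring
  -- The rational number `2 r den²` has an integral square, hence is an integer; its square is even,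
  -- so it is even itself.
  obtain ⟨z, hz'⟩ : ∃ z : ℤ, r * T.den ^ 2 = z := by
    obtain ⟨k, hk⟩ : IsSquare (2 * (T.den * (T.num ^ 3 - 2 * T.num ^ 2 * T.den + 2 * T.den ^ 3)) : ℤ) := by
      rw [← Rat.isSquare_intCast_iff]
      exact ⟨2 * (r * T.den ^ 2), by push_cast; rw [hz]; ring⟩
    have h2k : Even k := by
      have : Even (k * k) := hk ▸ even_two_mul _
      exact (Int.even_mul.1 this).elim id id
    obtain ⟨j, rfl⟩ := h2k
    have hk' : (2 : ℚ) * (T.den * (T.num ^ 3 - 2 * T.num ^ 2 * T.den + 2 * T.den ^ 3)) =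
      (j + j) * (j + j) := by exact_mod_cast hk
    rw [hz] at hk'
    rcases sq_eq_sq_iff_eq_or_eq_neg.1 (show (r * T.den ^ 2) ^ 2 = (j : ℚ) ^ 2 by linarith)
      with h1 | h1
    · exact ⟨j, h1⟩
    · exact ⟨-j, by rw [h1]; push_cast; rfl⟩
  rw [hz'] at hz
  have hz0 : z ≠ 0 := by
    rintro rfl
    exact mul_ne_zero hr0 (pow_ne_zero 2 hb') (by simpa using hz')
  obtain ⟨s, hs⟩ := trib_two_mul_eq_sq hd hg hab hb hz0 (by exact_mod_cast hz)
  obtain ⟨a, b, c, habc⟩ := trib_exists_coords (B := B) hd (s / T.den)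
  have hbK : (T.den : K) ≠ 0 := by exact_mod_cast T.den_ne_zero
  have hs2 : (2 : K) * (T + B.gen) = (a + b * B.gen + c * B.gen ^ 2) ^ 2 := by
    rw [← habc, div_pow, ← hs]
    have : (T.num : K) = T * T.den := by exact_mod_cast hTnd
    rw [this]
    push_cast
    field_simp
  -- Three equations from the coordinates of `2(T + π) = (a + bπ + cπ²)²`.
  obtain ⟨h1, h2, h3⟩ := trib_coords_eq_zero hd
    (a := a ^ 2 + 4 * b * c - 4 * c ^ 2 - 2 * T) (b := 2 * (a * b + c ^ 2) - 2)
    (c := b ^ 2 + 2 * a * c - 4 * b * c + 4 * c ^ 2) (by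
      push_cast
      linear_combination -hs2 - (2 * b * c + c ^ 2 * B.gen - 2 * c ^ 2) * hg)
  have hc : c ≠ 0 := by
    rintro rfl
    have hb0 : b = 0 := by simpa using h3
    rw [hb0] at h2
    norm_num at h2
  -- The third equation is the conic `(b - 2c)² + 2ac = 0`, parametrised by `b - 2c = -2cX`. The
  -- second equation then puts `(X, 1/c)` on the curve, and the first becomes the duplication
  -- formula.
  obtain ⟨X, hX⟩ : ∃ X : ℚ, b = 2 * c * (1 - X) := ⟨1 - b / (2 * c), by field_simp; ring⟩
  have ha : a = -2 * c * X ^ 2 := by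
    rw [hX] at h3
    have : 2 * c * (a + 2 * c * X ^ 2) = 0 := by linear_combination h3
    rcases mul_eq_zero.1 this with h | h
    · exact absurd h (by simpa using hc)
    · linarith
  have hD : c ^ 2 * (4 * X ^ 3 - 4 * X ^ 2 + 1) = 1 := by
    rw [ha, hX] at h2; linear_combination h2 / 2
  have hx : x = c ^ 2 * (X ^ 4 - 2 * X + 1) := by
    rw [ha, hX, hT] at h1; linear_combination -h1 / 4
  refine ⟨X, 1 / c, ?_, ?_⟩
  · field_simp; linear_combination -hD
  · rw [hx]; linear_combination (X ^ 4 - 2 * X + 1) * hD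

/-- The naive height of a rational number. -/
def Rat.naiveHeight (x : ℚ) : ℕ := max x.num.natAbs x.den

/-- Elimination leaves 11 as the only possible common prime, the cubic having a double root there.
Since the second form is a square, it would be divisible by 121, and an expansion around the double
root excludes this. -/
theorem isCoprime_halving {m n z : ℤ} (hmn : IsCoprime m n)
    (hz : n * (4 * m ^ 3 - 4 * m ^ 2 * n + n ^ 3) = z ^ 2) :
    IsCoprime (m ^ 4 - 2 * m * n ^ 3 + n ^ 4) (n * (4 * m ^ 3 - 4 * m ^ 2 * n + n ^ 3)) := by
  set d := 4 * m ^ 3 - 4 * m ^ 2 * n + n ^ 3 with hd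
  set e := 4 * m ^ 2 - 9 * m * n + 3 * n ^ 2 with he
  have main : ∀ p : ℤ, Prime p → p ∣ m ^ 4 - 2 * m * n ^ 3 + n ^ 4 → ¬ p ∣ n * d := by
    intro p hp hpN hpD
    have hpn : ¬ p ∣ n := fun h => by
      have h1 : p ∣ m ^ 4 := by
        have := dvd_sub hpN (h.mul_right (-2 * m * n ^ 2 + n ^ 3))
        rwa [show m ^ 4 - 2 * m * n ^ 3 + n ^ 4 - n * (-2 * m * n ^ 2 + n ^ 3) = m ^ 4 by ring]
          at this
      exact hp.not_isUnit (hmn.isUnit_of_dvd' (hp.dvd_of_dvd_pow h1) h)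
    have hpd : p ∣ d := (hp.dvd_or_dvd hpD).resolve_left hpn
    have hpe : p ∣ e := by
      have : p ∣ n ^ 2 * e :=
        (dvd_sub (hpN.mul_left 4) (hpd.mul_left (m + n))).trans
          (dvd_of_eq (by rw [hd, he]; ring))
      exact (hp.dvd_or_dvd this).resolve_left fun h => hpn (hp.dvd_of_dvd_pow h)
    have h11 : p ∣ 11 * n ^ 2 * (3 * m - n) :=
      (dvd_sub (hpd.mul_left 4) (hpe.mul_left (4 * m + 5 * n))).trans
        (dvd_of_eq (by rw [hd, he]; ring))
    rcases hp.dvd_or_dvd h11 with h11 | h3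
    · have hp11 : p ∣ 11 := (hp.dvd_or_dvd h11).resolve_right fun h => hpn (hp.dvd_of_dvd_pow h)
      have hass : Associated p 11 := hp.irreducible.associated_of_dvd
        (Int.prime_iff_natAbs_prime.2 (by norm_num)).irreducible hp11
      have hpe' := hass.symm.dvd.trans hpe
      have hpn' : ¬ (11 : ℤ) ∣ n := fun h => hpn (hass.dvd.trans h)
      have hp11' : Prime (11 : ℤ) := Int.prime_iff_natAbs_prime.2 (by norm_num)
      -- Modulo 11, `e` is `4(m - 8n)²`.
      have h8 : (11 : ℤ) ∣ m - 8 * n := by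
        have : (11 : ℤ) ∣ 4 * (m - 8 * n) ^ 2 :=
          (dvd_add hpe' (Dvd.intro (-5 * m * n + 23 * n ^ 2) rfl)).trans
            (dvd_of_eq (by rw [he]; ring))
        rcases hp11'.dvd_or_dvd this with h | h
        · norm_num at h
        · exact hp11'.dvd_of_dvd_pow h
      obtain ⟨k, hk⟩ := h8
      obtain rfl : m = 8 * n + 11 * k := by linarith
      have hzz : z ^ 2 = 11 * (163 * n ^ 4 +
          11 * (64 * n ^ 3 * k + 92 * n ^ 2 * k ^ 2 + 44 * n * k ^ 3)) := by
        rw [← hz, hd]; ring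
      have h11z : (11 : ℤ) ∣ z := hp11'.dvd_of_dvd_pow ⟨_, hzz⟩
      obtain ⟨w, rfl⟩ := h11z
      have : (11 : ℤ) ∣ 163 * n ^ 4 :=
        ⟨w ^ 2 - (64 * n ^ 3 * k + 92 * n ^ 2 * k ^ 2 + 44 * n * k ^ 3), by linarith⟩
      rcases hp11'.dvd_or_dvd this with h | h
      · norm_num at h
      · exact hpn' (hp11'.dvd_of_dvd_pow h)
    · have h4 : p ∣ 4 * m ^ 2 := by
        exact (dvd_add hpe (h3.mul_left (3 * n))).trans
          (dvd_of_eq (by rw [he]; ring))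
      rcases hp.dvd_or_dvd h4 with h4 | h4
      · have h5 : p ∣ n ^ 3 :=
          (dvd_sub hpd (h4.mul_right (m ^ 3 - m ^ 2 * n))).trans
            (dvd_of_eq (by rw [hd]; ring))
        exact hpn (hp.dvd_of_dvd_pow h5)
      · have h5 := hp.dvd_of_dvd_pow h4
        have : p ∣ n := by
          have := dvd_sub (h5.mul_left 3) h3
          simpa using this
        exact hpn this
  refine isCoprime_of_prime_dvd ?_ main
  rintro ⟨h1, h2⟩
  exact main 2 Int.prime_two (h1 ▸ dvd_zero _) (h2 ▸ dvd_zero _)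

/-- For `m < 0` every term of the quartic form is positive and it dominates; for `m > 0` the other
form does. -/
theorem max_lt_halving {m n : ℤ} (hmn : IsCoprime m n) (hn : 0 < n) (h0 : m ≠ 0)
    (h1 : m ≠ n) :
    max |m| n < max |m ^ 4 - 2 * m * n ^ 3 + n ^ 4| (n * (4 * m ^ 3 - 4 * m ^ 2 * n + n ^ 3)) := by
  rcases lt_or_gt_of_ne h0 with hm | hm
  · refine lt_max_of_lt_left (lt_of_lt_of_le ?_ (le_abs_self _))
    obtain ⟨k, rfl⟩ : ∃ k, m = -k := ⟨-m, by ring⟩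
    have hk : 1 ≤ k := by omega
    have hn' : 1 ≤ n := hn
    have e1 : k ≤ k ^ 4 := le_self_pow₀ hk (by norm_num)
    have e2 : n ≤ n ^ 4 := le_self_pow₀ hn' (by norm_num)
    have e3 : 0 < k * n ^ 3 := by positivity
    rw [abs_neg, abs_of_pos (by omega)]
    refine max_lt ?_ ?_ <;> nlinarith
  · refine lt_max_of_lt_right ?_
    rw [abs_of_pos hm]
    rcases lt_or_gt_of_ne h1 with h | h
    · rw [max_eq_right h.le]
      have hn2 : 2 ≤ n := by omega
      -- On `t ≥ 0` the minimum of `4t³ - 4t² + 1` is `11/27`, at `t = 2/3`; this suffices because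
      -- `n ≥ 2`.
      have h27 : 27 * (4 * m ^ 3 - 4 * m ^ 2 * n + n ^ 3) =
        4 * (3 * m - 2 * n) ^ 2 * (3 * m + n) + 11 * n ^ 3 := by ring
      have hpos : 0 ≤ 4 * (3 * m - 2 * n) ^ 2 * (3 * m + n) := by positivity
      have h8 : 2 ^ 3 ≤ n ^ 3 := by gcongr
      nlinarith
    · rw [max_eq_left h.le]
      have e1 : 4 * m ^ 2 + 1 ≤ 4 * m ^ 3 - 4 * m ^ 2 * n + n ^ 3 := by
        have : 4 * m ^ 2 * 1 ≤ 4 * m ^ 2 * (m - n) := by gcongr; omega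
        have : 0 < n ^ 3 := by positivity
        nlinarith
      nlinarith

/-- By coprimality the duplication formula gives the numerator and denominator of `x` without
cancellation. -/
theorem Rat.naiveHeight_lt_of_halving {x x' r' : ℚ} (h' : r' ^ 2 = 4 * x' ^ 3 - 4 * x' ^ 2 + 1)
    (h : x * (4 * x' ^ 3 - 4 * x' ^ 2 + 1) = x' ^ 4 - 2 * x' + 1) (h0 : x' ≠ 0) (h1 : x' ≠ 1) :
    x'.naiveHeight < x.naiveHeight := by
  set m := x'.num with hm
  set n : ℤ := (x'.den : ℤ) with hn
  have hnpos : 0 < n := by rw [hn]; exact_mod_cast x'.den_pos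
  have hnq : (n : ℚ) ≠ 0 := by exact_mod_cast hnpos.ne'
  have hmq : (m : ℚ) = x' * n := by rw [hm, hn]; exact_mod_cast (Rat.mul_den_eq_num x').symm
  have hmn : IsCoprime m n := Int.isCoprime_iff_gcd_eq_one.2 x'.reduced
  obtain ⟨z, hz⟩ : IsSquare (n * (4 * m ^ 3 - 4 * m ^ 2 * n + n ^ 3)) := by
    rw [← Rat.isSquare_intCast_iff]
    refine ⟨r' * n ^ 2, ?_⟩
    push_cast
    rw [hmq]
    linear_combination -(n : ℚ) ^ 4 * h'
  rw [← pow_two] at hz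
  have hcop := isCoprime_halving hmn hz
  have hlt := max_lt_halving hmn hnpos (fun h => h0 (Rat.num_eq_zero.1 h)) (fun h => h1 (by
    rw [h] at hmq
    exact (mul_right_cancel₀ hnq (by rw [← hmq, one_mul])).symm))
  set N := m ^ 4 - 2 * m * n ^ 3 + n ^ 4 with hN
  set D := n * (4 * m ^ 3 - 4 * m ^ 2 * n + n ^ 3) with hD
  have hxD : x * D = N := by
    rw [hD, hN]; push_cast; rw [hmq]
    linear_combination (n : ℚ) ^ 4 * h
  have hDpos : 0 < D := by
    rcases (hz ▸ sq_nonneg z : 0 ≤ D).lt_or_eq with h | h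
    · exact h
    · exfalso
      rw [← h, Int.cast_zero, mul_zero] at hxD
      have hN0 : N = 0 := by exact_mod_cast hxD.symm
      rw [hN0, ← h] at hcop
      exact not_isUnit_zero (isCoprime_zero_left.1 hcop)
  have hx : x = N / D := by rw [← hxD]; field_simp
  have hnum : x.num = N := by
    rw [hx]; exact Rat.num_div_eq_of_coprime hDpos (Int.isCoprime_iff_gcd_eq_one.1 hcop)
  have hden : (x.den : ℤ) = D := by
    rw [hx]; exact Rat.den_div_eq_of_coprime hDpos (Int.isCoprime_iff_gcd_eq_one.1 hcop)
  have : ((x'.naiveHeight : ℕ) : ℤ) < (x.naiveHeight : ℕ) := by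
    simp only [Rat.naiveHeight]
    push_cast
    rw [hnum, hden]
    exact hlt
  exact_mod_cast this

theorem eq_zero_or_one_of_sq {x r : ℚ} (h : r ^ 2 = 4 * x ^ 3 - 4 * x ^ 2 + 1) :
    x = 0 ∨ x = 1 := by
  induction hn : x.naiveHeight using Nat.strong_induction_on generalizing x r with
  | _ n ih =>
    obtain ⟨x', r', h', hx⟩ := exists_halving h
    have hx' : x' = 0 ∨ x' = 1 := by
      by_contra! hcon
      have hlt := Rat.naiveHeight_lt_of_halving h' hx hcon.1 hcon.2
      rcases ih _ (hn ▸ hlt) h' rfl with h | h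
      · exact hcon.1 h
      · exact hcon.2 h
    -- Doubling exchanges the x-coordinates 0 and 1.
    rcases hx' with rfl | rfl
    · right; linarith
    · left; linarith

theorem rational_points_weierstrassCubic (x y : ℚ) :
    y ^ 2 + y = x ^ 3 - x ^ 2 ↔ (x = 0 ∨ x = 1) ∧ (y = 0 ∨ y = -1) := by
  constructor
  · intro h
    have hx : x = 0 ∨ x = 1 := eq_zero_or_one_of_sq (r := 2 * y + 1) (by linarith)
    refine ⟨hx, ?_⟩
    have : y * (y + 1) = 0 := by rcases hx with rfl | rfl <;> linarith
    rcases mul_eq_zero.1 this with h | h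
    · exact Or.inl h
    · right; linarith
  · rintro ⟨rfl | rfl, rfl | rfl⟩ <;> norm_num

theorem rational_points_elkiesCubic (x y : ℚ) :
    2 * y ^ 2 = x ^ 3 + x ^ 2 - x + 1 ↔ (x = 1 ∨ x = -1) ∧ (y = 1 ∨ y = -1) := by
  constructor
  · intro h
    obtain ⟨h1, h2⟩ := (rational_points_weierstrassCubic ((x + 1) / 2) ((y - 1) / 2)).1 (by linarith)
    refine ⟨?_, ?_⟩
    · rcases h1 with h1 | h1
      · right; linarith
      · left; linarith
    · rcases h2 with h2 | h2
      · left; linarith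
      · right; linarith
  · rintro ⟨rfl | rfl, rfl | rfl⟩ <;> norm_num

/-! ### Changes of variables as group homomorphisms -/

namespace WeierstrassCurve

open WeierstrassCurve.Affine

variable {K : Type*} [Field K]

theorem variableChange_equation_iff (W : WeierstrassCurve K) (C : VariableChange K) (x y : K) :
    (C • W).toAffine.Equation x y ↔ W.toAffine.Equation ((C.u : K) ^ 2 * x + C.r)
      ((C.u : K) ^ 3 * y + (C.u : K) ^ 2 * C.s * x + C.t) := by
  rw [equation_iff', equation_iff', variableChange_def]
  simp only [Units.val_inv_eq_inv_val]
  have hu : (C.u : K) ≠ 0 := C.u.ne_zero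
  rw [← mul_right_inj' (pow_ne_zero 6 hu), mul_zero]
  refine Eq.congr_left ?_
  field_simp
  ring

theorem variableChange_negY (W : WeierstrassCurve K) (C : VariableChange K) (x y : K) :
    W.toAffine.negY ((C.u : K) ^ 2 * x + C.r)
      ((C.u : K) ^ 3 * y + (C.u : K) ^ 2 * C.s * x + C.t) =
    (C.u : K) ^ 3 * (C • W).toAffine.negY x y + (C.u : K) ^ 2 * C.s * x + C.t := by
  have hu : (C.u : K) ≠ 0 := C.u.ne_zero
  simp only [negY, variableChange_def, Units.val_inv_eq_inv_val]
  field_simp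
  ring

variable [DecidableEq K]

/-- The change of variables takes a line of slope `ℓ` to one of slope `uℓ + s`; for tangents this is
checked on the slope formula. -/
theorem variableChange_slope (W : WeierstrassCurve K) (C : VariableChange K) {x₁ x₂ y₁ y₂ : K}
    (h₁ : (C • W).toAffine.Equation x₁ y₁) (h₂ : (C • W).toAffine.Equation x₂ y₂)
    (h : ¬ (x₁ = x₂ ∧ y₁ = (C • W).toAffine.negY x₂ y₂)) :
    W.toAffine.slope ((C.u : K) ^ 2 * x₁ + C.r) ((C.u : K) ^ 2 * x₂ + C.r)
      ((C.u : K) ^ 3 * y₁ + (C.u : K) ^ 2 * C.s * x₁ + C.t)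
      ((C.u : K) ^ 3 * y₂ + (C.u : K) ^ 2 * C.s * x₂ + C.t) =
    C.u * (C • W).toAffine.slope x₁ x₂ y₁ y₂ + C.s := by
  have hu : (C.u : K) ≠ 0 := C.u.ne_zero
  by_cases hx : x₁ = x₂
  · subst hx
    have hy : y₁ ≠ (C • W).toAffine.negY x₁ y₂ := fun hy => h ⟨rfl, hy⟩
    obtain rfl : y₁ = y₂ := Y_eq_of_Y_ne h₁ h₂ rfl hy
    rw [slope_of_Y_ne rfl hy, slope_of_Y_ne rfl (by
      rw [variableChange_negY]
      intro h'
      apply hy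
      have := add_right_cancel (add_right_cancel h')
      exact mul_left_cancel₀ (pow_ne_zero 3 hu) this)]
    rw [variableChange_negY]
    have hd : y₁ - (C • W).toAffine.negY x₁ y₁ ≠ 0 := sub_ne_zero.2 hy
    have hd' : (C.u : K) ^ 3 * y₁ + (C.u : K) ^ 2 * C.s * x₁ + C.t -
      ((C.u : K) ^ 3 * (C • W).toAffine.negY x₁ y₁ + (C.u : K) ^ 2 * C.s * x₁ + C.t) =
      (C.u : K) ^ 3 * (y₁ - (C • W).toAffine.negY x₁ y₁) := by ring
    rw [hd']
    have hn : (C.u : K) ^ 3 * (y₁ - (C • W).toAffine.negY x₁ y₁) =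
        2 * (C.u : K) ^ 3 * y₁ + (C.u : K) ^ 2 * (W.a₁ + 2 * C.s) * x₁ +
          (W.a₃ + C.r * W.a₁ + 2 * C.t) := by
      simp only [negY, variableChange_def, Units.val_inv_eq_inv_val]
      field_simp
      ring
    have hq : ∀ n : K, C.u * (n / (y₁ - (C • W).toAffine.negY x₁ y₁)) *
        ((C.u : K) ^ 3 * (y₁ - (C • W).toAffine.negY x₁ y₁)) = (C.u : K) ^ 4 * n := fun n => by
      field_simp
    rw [div_eq_iff (mul_ne_zero (pow_ne_zero 3 hu) hd), add_mul, hq, hn]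
    simp only [variableChange_def, Units.val_inv_eq_inv_val]
    field_simp
    ring
  · have hd : x₁ - x₂ ≠ 0 := sub_ne_zero.2 hx
    have hx' : (C.u : K) ^ 2 * x₁ + C.r ≠ (C.u : K) ^ 2 * x₂ + C.r := fun h' =>
      hx (mul_left_cancel₀ (pow_ne_zero 2 hu) (add_right_cancel h'))
    have hd' : (C.u : K) ^ 2 * x₁ + C.r - ((C.u : K) ^ 2 * x₂ + C.r) =
      (C.u : K) ^ 2 * (x₁ - x₂) := by ring
    rw [slope_of_X_ne hx, slope_of_X_ne hx', hd']
    field_simp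
    ring

/-- The homomorphism on points `(x, y) ↦ (u²x + r, u³y + u²sx + t)` of a change of variables. -/
noncomputable def variableChangeHom (W : WeierstrassCurve K) [W.IsElliptic]
    (C : VariableChange K) : (C • W).toAffine.Point →+ W.toAffine.Point where
  toFun
    | .zero => .zero
    | .some x y h => .some ((C.u : K) ^ 2 * x + C.r)
        ((C.u : K) ^ 3 * y + (C.u : K) ^ 2 * C.s * x + C.t)
        (equation_iff_nonsingular.1 ((variableChange_equation_iff W C x y).1 h.1))
  map_zero' := rfl
  map_add' := by
    have hu : (C.u : K) ≠ 0 := C.u.ne_zero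
    rintro (_ | ⟨x₁, y₁, h₁⟩) (_ | ⟨x₂, y₂, h₂⟩)
    · rfl
    · rfl
    · rfl
    · by_cases hxy : x₁ = x₂ ∧ y₁ = (C • W).toAffine.negY x₂ y₂
      · rw [Point.add_of_Y_eq hxy.1 hxy.2, Point.add_of_Y_eq]
        · rfl
        · rw [hxy.1]
        · rw [variableChange_negY, ← hxy.2, hxy.1]
      · have hxy' : ¬ ((C.u : K) ^ 2 * x₁ + C.r = (C.u : K) ^ 2 * x₂ + C.r ∧
          (C.u : K) ^ 3 * y₁ + (C.u : K) ^ 2 * C.s * x₁ + C.t = W.toAffine.negY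
            ((C.u : K) ^ 2 * x₂ + C.r)
            ((C.u : K) ^ 3 * y₂ + (C.u : K) ^ 2 * C.s * x₂ + C.t)) := by
          rw [variableChange_negY]
          rintro ⟨hx, hy⟩
          obtain rfl := mul_left_cancel₀ (pow_ne_zero 2 hu) (add_right_cancel hx)
          exact hxy ⟨rfl, mul_left_cancel₀ (pow_ne_zero 3 hu)
            (add_right_cancel (add_right_cancel hy))⟩
        rw [Point.add_some hxy, Point.add_some hxy']
        simp only [variableChange_slope W C h₁.1 h₂.1 hxy, Point.some.injEq]
        generalize (C • W).toAffine.slope x₁ x₂ y₁ y₂ = ℓ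
        simp only [addX, addY, negAddY, negY, variableChange_def, Units.val_inv_eq_inv_val]
        constructor
        · field_simp; ring
        · field_simp; ring

theorem variableChangeHom_injective (W : WeierstrassCurve K) [W.IsElliptic]
    (C : VariableChange K) : Function.Injective (variableChangeHom W C) := by
  rw [injective_iff_map_eq_zero]
  rintro (_ | ⟨x, y, h⟩) h0
  · rfl
  · exact absurd h0 (Point.some_ne_zero _)

theorem addOrderOf_variableChange {W W' : WeierstrassCurve K} [W.IsElliptic]
    {C : VariableChange K} (hC : C • W = W') {x y x' y' : K}
    (h : W.toAffine.Nonsingular x y) (h' : W'.toAffine.Nonsingular x' y')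
    (hx : x = (C.u : K) ^ 2 * x' + C.r)
    (hy : y = (C.u : K) ^ 3 * y' + (C.u : K) ^ 2 * C.s * x' + C.t) :
    addOrderOf (Point.some x' y' h') = addOrderOf (Point.some x y h) := by
  subst hC hx hy
  exact (addOrderOf_injective _ (variableChangeHom_injective W C) _).symm

end WeierstrassCurve

/-! ### The Tate normal form -/

namespace WeierstrassCurve

open WeierstrassCurve.Affine

variable {K : Type*} [Field K]

/-- The Tate normal form `y² + (1 - c) x y - b y = x³ - b x²`. -/
def tateCurve (b c : K) : WeierstrassCurve K := ⟨1 - c, -b, -b, 0, 0⟩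

theorem tateCurve_Δ (b c : K) : (tateCurve b c).Δ = b ^ 3 *
    (16 * b ^ 2 - 8 * b * c ^ 2 - 20 * b * c + b + c ^ 4 - 3 * c ^ 3 + 3 * c ^ 2 - c) := by
  simp only [tateCurve, Δ, b₂, b₄, b₆, b₈]
  ring

theorem tateCurve_equation_zero (b c : K) : (tateCurve b c).toAffine.Equation 0 0 := by
  rw [equation_iff]
  simp [tateCurve]

/-- A point with `x = 0` is one of `±(0, 0)`. -/
theorem eq_or_eq_neg_of_X_eq_zero {W : WeierstrassCurve K} {y : K} (h : W.toAffine.Nonsingular 0 y)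
    (h0 : W.toAffine.Nonsingular 0 0) :
    Point.some 0 y h = Point.some 0 0 h0 ∨ Point.some 0 y h = -Point.some 0 0 h0 :=
  Point.X_eq_iff.1 rfl

variable [DecidableEq K]

/-- The slope `ℓ` of the chord through the origin is an argument, so that each further multiple of
`(0, 0)` is a polynomial identity once `ℓ` is named. -/
theorem tateCurve_add {b c x y ℓ x' y' : K} (hx : x ≠ 0)
    (h : (tateCurve b c).toAffine.Nonsingular x y) (h0 : (tateCurve b c).toAffine.Nonsingular 0 0)
    (hℓ : y = ℓ * x) (hx' : x' = ℓ ^ 2 + (1 - c) * ℓ + b - x)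
    (hy' : y' = -ℓ * x' - (1 - c) * x' + b) :
    ∃ h' : (tateCurve b c).toAffine.Nonsingular x' y',
      Point.some x y h + Point.some 0 0 h0 = Point.some x' y' h' := by
  have hsl : (tateCurve b c).toAffine.slope x 0 y 0 = ℓ := by
    rw [slope_of_X_ne hx, hℓ]; field_simp; ring
  have e1 : (tateCurve b c).toAffine.addX x 0 ((tateCurve b c).toAffine.slope x 0 y 0) = x' := by
    rw [hsl, hx']; simp only [addX, tateCurve]; ring
  have e2 : (tateCurve b c).toAffine.addY x 0 y ((tateCurve b c).toAffine.slope x 0 y 0) = y' := by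
    rw [addY, negAddY, e1, hsl, hy', negY, hℓ]; simp only [tateCurve]; ring
  have hns := nonsingular_add h h0 (fun hxy => hx hxy.1)
  rw [e1, e2] at hns
  refine ⟨hns, ?_⟩
  rw [Point.add_of_X_ne hx]
  simp only [e1, e2]

theorem tateCurve_two_nsmul {b c : K} (hb : b ≠ 0)
    (h0 : (tateCurve b c).toAffine.Nonsingular 0 0) :
    ∃ h' : (tateCurve b c).toAffine.Nonsingular b (b * c),
      2 • Point.some 0 0 h0 = Point.some b (b * c) h' := by
  have hy : (0 : K) ≠ (tateCurve b c).toAffine.negY 0 0 := by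
    simpa [negY, tateCurve] using hb.symm
  have hsl : (tateCurve b c).toAffine.slope 0 0 0 0 = 0 := by
    rw [slope_of_Y_ne rfl hy]; simp [tateCurve]
  have e1 : (tateCurve b c).toAffine.addX 0 0 ((tateCurve b c).toAffine.slope 0 0 0 0) = b := by
    rw [hsl]; simp [addX, tateCurve]
  have e2 : (tateCurve b c).toAffine.addY 0 0 0 ((tateCurve b c).toAffine.slope 0 0 0 0) =
      b * c := by
    rw [addY, negAddY, e1, hsl, negY]; simp only [tateCurve]; ring
  have hns := nonsingular_add h0 h0 (fun hxy => hy hxy.2)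
  rw [e1, e2] at hns
  refine ⟨hns, ?_⟩
  rw [two_nsmul, Point.add_self_of_Y_ne hy]
  simp only [e1, e2]

theorem tateCurve_three_nsmul {b c : K} (hb : b ≠ 0)
    (h0 : (tateCurve b c).toAffine.Nonsingular 0 0) :
    ∃ h' : (tateCurve b c).toAffine.Nonsingular c (b - c),
      3 • Point.some 0 0 h0 = Point.some c (b - c) h' := by
  obtain ⟨h2, e2⟩ := tateCurve_two_nsmul hb h0
  rw [succ_nsmul, e2]
  exact tateCurve_add hb h2 h0 (ℓ := c) (by ring) (by ring) (by ring)

theorem tateCurve_four_nsmul {c r : K} (hc : c ≠ 0) (hr : r ≠ 0)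
    (h0 : (tateCurve (r * c) c).toAffine.Nonsingular 0 0) :
    ∃ h' : (tateCurve (r * c) c).toAffine.Nonsingular (r * (r - 1)) (r ^ 2 * (c - r + 1)),
      4 • Point.some 0 0 h0 = Point.some (r * (r - 1)) (r ^ 2 * (c - r + 1)) h' := by
  obtain ⟨h3, e3⟩ := tateCurve_three_nsmul (mul_ne_zero hr hc) h0
  rw [succ_nsmul, e3]
  exact tateCurve_add hc h3 h0 (ℓ := r - 1) (by ring) (by ring) (by ring)

theorem tateCurve_five_nsmul {r s : K} (hr : r ≠ 0) (hr1 : r - 1 ≠ 0) (hs : s ≠ 0)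
    (h0 : (tateCurve (r * (s * (r - 1))) (s * (r - 1))).toAffine.Nonsingular 0 0) :
    ∃ h' : (tateCurve (r * (s * (r - 1))) (s * (r - 1))).toAffine.Nonsingular
        (r * s * (s - 1)) (r * s ^ 2 * (r - s)),
      5 • Point.some 0 0 h0 = Point.some (r * s * (s - 1)) (r * s ^ 2 * (r - s)) h' := by
  obtain ⟨h4, e4⟩ := tateCurve_four_nsmul (mul_ne_zero hs hr1) hr h0
  rw [succ_nsmul, e4]
  exact tateCurve_add (mul_ne_zero hr hr1) h4 h0 (ℓ := r * (s - 1)) (by ring) (by ring) (by ring)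

theorem tateCurve_six_nsmul {r s : K} (hr : r ≠ 0) (hr1 : r - 1 ≠ 0) (hs : s ≠ 0)
    (hs1 : s - 1 ≠ 0)
    (h0 : (tateCurve (r * (s * (r - 1))) (s * (r - 1))).toAffine.Nonsingular 0 0) :
    ∃ (y : K) (h' : (tateCurve (r * (s * (r - 1))) (s * (r - 1))).toAffine.Nonsingular
        (s * (r - 1) * (r - s) / (s - 1) ^ 2) y),
      6 • Point.some 0 0 h0 = Point.some (s * (r - 1) * (r - s) / (s - 1) ^ 2) y h' := by
  obtain ⟨h5, e5⟩ := tateCurve_five_nsmul hr hr1 hs h0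
  rw [succ_nsmul, e5]
  exact ⟨_, tateCurve_add (mul_ne_zero (mul_ne_zero hr hs) hs1) h5 h0 (ℓ := s * (r - s) / (s - 1))
    (by field_simp) (by field_simp; ring) rfl⟩

/-- On the Tate normal form, the origin has order `11` exactly on `r (s - 1)³ = (r - 1) (r - s)`. -/
theorem tateCurve_addOrderOf_eq_eleven {r s : K} (hr : r ≠ 0) (hr1 : r - 1 ≠ 0) (hs : s ≠ 0)
    (hs1 : s - 1 ≠ 0)
    (h0 : (tateCurve (r * (s * (r - 1))) (s * (r - 1))).toAffine.Nonsingular 0 0)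
    (h : r * (s - 1) ^ 3 = (r - 1) * (r - s)) : addOrderOf (Point.some 0 0 h0) = 11 := by
  obtain ⟨h5, e5⟩ := tateCurve_five_nsmul hr hr1 hs h0
  obtain ⟨y, h6, e6⟩ := tateCurve_six_nsmul hr hr1 hs hs1 h0
  have hx : r * s * (s - 1) = s * (r - 1) * (r - s) / (s - 1) ^ 2 := by
    field_simp
    linear_combination h
  have hP : Point.some 0 0 h0 ≠ 0 := Point.some_ne_zero _
  refine addOrderOf_eq_prime (p := 11) (hp := ⟨by norm_num⟩) ?_ hP
  -- Equal x-coordinates mean `6P = 5P`, which is impossible as `P ≠ 0`, or `5P = -6P`.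
  rcases Point.X_eq_iff (h₁ := h5) (h₂ := h6).1 hx with h1 | h1
  · rw [← e5, ← e6, succ_nsmul _ 5] at h1
    exact absurd (left_eq_add.1 h1) hP
  · rw [← e5, ← e6] at h1
    rw [show 11 = 5 + 6 by rfl, add_nsmul, h1, neg_add_cancel]

theorem exists_tate_parameters {b c : K} (h0 : (tateCurve b c).toAffine.Nonsingular 0 0)
    (hord : addOrderOf (Point.some 0 0 h0) = 11) :
    ∃ r s : K, r ≠ 0 ∧ r - 1 ≠ 0 ∧ s ≠ 0 ∧ s - 1 ≠ 0 ∧ b = r * (s * (r - 1)) ∧ c = s * (r - 1) ∧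
      r * (s - 1) ^ 3 = (r - 1) * (r - s) := by
  set P := Point.some 0 0 h0 with hPdef
  have hn : ∀ k : ℕ, 0 < k → k < 11 → k • P ≠ 0 := fun k hk hk' h => by
    have := Nat.le_of_dvd hk (addOrderOf_dvd_of_nsmul_eq_zero h)
    omega
  -- If `x(kP) = 0`, then `kP = ±P` and `(k ∓ 1)P = 0`. For `k = 3, 4, 5` this yields `c ≠ 0`, `r ≠
  -- 1` and `s ≠ 1`.
  have hpm : ∀ k : ℕ, 1 < k → k < 10 → ∀ x y (h : (tateCurve b c).toAffine.Nonsingular x y),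
      k • P = Point.some x y h → x ≠ 0 := by
    rintro k hk hk' x y h e rfl
    rcases eq_or_eq_neg_of_X_eq_zero h h0 with h1 | h1
    · apply hn (k - 1) (by omega) (by omega)
      rw [← e] at h1
      have : (k - 1) • P + P = 0 + P := by rw [← succ_nsmul, Nat.sub_add_cancel hk.le, h1, zero_add]
      exact add_right_cancel this
    · apply hn (k + 1) (by omega) (by omega)
      rw [succ_nsmul, e, h1]; exact neg_add_cancel _
  have hb : b ≠ 0 := by
    rintro rfl
    apply hn 2 (by norm_num) (by norm_num)
    rw [two_nsmul]
    exact Point.add_self_of_Y_eq (by simp [negY, tateCurve])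
  obtain ⟨h3, e3⟩ := tateCurve_three_nsmul hb h0
  have hc : c ≠ 0 := hpm 3 (by norm_num) (by norm_num) _ _ _ e3
  obtain ⟨r, rfl⟩ : ∃ r, b = r * c := ⟨b / c, by field_simp⟩
  have hr : r ≠ 0 := left_ne_zero_of_mul hb
  obtain ⟨h4, e4⟩ := tateCurve_four_nsmul hc hr h0
  have hr1 : r - 1 ≠ 0 := right_ne_zero_of_mul (hpm 4 (by norm_num) (by norm_num) _ _ _ e4)
  obtain ⟨s, rfl⟩ : ∃ s, c = s * (r - 1) := ⟨c / (r - 1), by field_simp⟩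
  have hs : s ≠ 0 := left_ne_zero_of_mul hc
  obtain ⟨h5, e5⟩ := tateCurve_five_nsmul hr hr1 hs h0
  have hs1 : s - 1 ≠ 0 := right_ne_zero_of_mul (hpm 5 (by norm_num) (by norm_num) _ _ _ e5)
  obtain ⟨y, h6, e6⟩ := tateCurve_six_nsmul hr hr1 hs hs1 h0
  refine ⟨r, s, hr, hr1, hs, hs1, rfl, rfl, ?_⟩
  have h11 : (5 + 6) • P = 0 := addOrderOf_dvd_iff_nsmul_eq_zero.1 (by rw [hord])
  rw [add_nsmul, hPdef, e5, e6, add_eq_zero_iff_eq_neg] at h11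
  have hx := (Point.X_eq_iff (h₁ := h5) (h₂ := h6)).2 (Or.inr h11)
  rw [eq_div_iff (pow_ne_zero 2 hs1)] at hx
  apply mul_left_cancel₀ hs
  linear_combination hx

end WeierstrassCurve

/-! ### Pairs `(E, P)` and their normal form -/

namespace WeierstrassCurve

theorem ne_zero_of_tateCurve_Δ_ne_zero {K : Type*} [Field K] {b c : K} (hΔ : (tateCurve b c).Δ ≠ 0) : b ≠ 0 := by
  rintro rfl
  simp [tateCurve_Δ] at hΔ

end WeierstrassCurve

namespace TorsionPair

open WeierstrassCurve WeierstrassCurve.Affine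

variable {K : Type*} [Field K] [DecidableEq K] {N : ℕ}

theorem Iso.symm {A B : TorsionPair N K} (h : A.Iso B) : B.Iso A := by
  obtain ⟨c, hc, hx, hy⟩ := h
  have hu : (c.u : K) ≠ 0 := c.u.ne_zero
  refine ⟨c⁻¹, by rw [← hc, inv_smul_smul], ?_, ?_⟩
  · simp only [VariableChange.inv_def, Units.val_inv_eq_inv_val, hx]
    field_simp
    ring
  · simp only [VariableChange.inv_def, Units.val_inv_eq_inv_val, hx, hy]
    field_simp
    ring

theorem Iso.trans {A B C : TorsionPair N K} (h : A.Iso B) (h' : B.Iso C) : A.Iso C := by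
  obtain ⟨c, hc, hx, hy⟩ := h
  obtain ⟨c', hc', hx', hy'⟩ := h'
  refine ⟨c' * c, by rw [← hc', ← hc, mul_smul], ?_, ?_⟩
  · simp only [VariableChange.mul_def, Units.val_mul, hx, hx']
    ring
  · simp only [VariableChange.mul_def, Units.val_mul, hy, hx', hy']
    ring

/-- The coefficient `a₃` of the curve after translation of the point to the origin. -/
def a₃' (A : TorsionPair N K) : K := A.W.a₃ + A.x * A.W.a₁ + 2 * A.y

/-- The slope of the tangent at the point. -/
def slope' (A : TorsionPair N K) : K :=
  (A.W.a₄ + 2 * A.x * A.W.a₂ - A.y * A.W.a₁ + 3 * A.x ^ 2) / A.a₃'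

/-- The coefficient `a₂` of the curve in coordinates where the tangent at the point is `y = 0`. -/
def a₂' (A : TorsionPair N K) : K :=
  A.W.a₂ - A.slope' * A.W.a₁ + 3 * A.x - A.slope' ^ 2

/-- The parameter `b` of the Tate normal form. -/
def tateB (A : TorsionPair N K) : K := -(A.a₂' ^ 3 / A.a₃' ^ 2)

/-- The parameter `c` of the Tate normal form. -/
def tateC (A : TorsionPair N K) : K := 1 - (A.W.a₁ + 2 * A.slope') * A.a₂' / A.a₃'

theorem equation (A : TorsionPair N K) : A.y ^ 2 + A.W.a₁ * A.x * A.y + A.W.a₃ * A.y =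
    A.x ^ 3 + A.W.a₂ * A.x ^ 2 + A.W.a₄ * A.x + A.W.a₆ :=
  (equation_iff _ _).1 A.nonsingular.1

theorem a₃'_ne_zero (A : TorsionPair 11 K) : A.a₃' ≠ 0 := by
  intro h
  have hP : 2 • Point.some A.x A.y A.nonsingular = 0 := by
    rw [two_nsmul]
    refine Point.add_self_of_Y_eq ?_
    rw [a₃'] at h
    rw [negY]
    linear_combination h
  have := addOrderOf_dvd_of_nsmul_eq_zero hP
  rw [A.order] at this
  norm_num at this

/-- The point is translated to the origin and its tangent sheared to `y = 0`, which kills `a₆` and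
`a₄`. -/
theorem smul_eq_of_u_eq_one (A : TorsionPair 11 K) :
    (⟨1, A.x, A.slope', A.y⟩ : VariableChange K) • A.W =
      ⟨A.W.a₁ + 2 * A.slope', A.a₂', A.a₃', 0, 0⟩ := by
  have h3 := A.a₃'_ne_zero
  have hs : A.slope' * A.a₃' =
      A.W.a₄ + 2 * A.x * A.W.a₂ - A.y * A.W.a₁ + 3 * A.x ^ 2 := div_mul_cancel₀ _ h3
  have he := A.equation
  rw [a₃'] at hs
  rw [variableChange_def]
  ext <;> simp only [inv_one, Units.val_one, one_pow, one_mul, a₂', a₃']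
  · linear_combination -hs
  · linear_combination -he

/-- If `a₂'` vanished, the tangent `y = 0` would meet the curve triply at the point, so that `3P =
0`. -/
theorem a₂'_ne_zero (A : TorsionPair 11 K) : A.a₂' ≠ 0 := by
  intro h
  have h3 := A.a₃'_ne_zero
  have hW := A.smul_eq_of_u_eq_one
  have := A.elliptic
  rw [h] at hW
  set W' : WeierstrassCurve K := ⟨A.W.a₁ + 2 * A.slope', 0, A.a₃', 0, 0⟩ with hW'
  have h0 : W'.toAffine.Nonsingular 0 0 := by
    rw [nonsingular_zero]
    exact ⟨rfl, Or.inl h3⟩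
  have hord := addOrderOf_variableChange hW A.nonsingular h0 (by simp) (by simp)
  rw [A.order] at hord
  have hy : (0 : K) ≠ W'.toAffine.negY 0 0 := by
    simpa [negY, hW'] using h3
  have hx : W'.toAffine.addX 0 0 (W'.toAffine.slope 0 0 0 0) = 0 := by
    rw [slope_of_Y_ne rfl hy]; simp [addX, hW']
  have key : ∀ k : ℕ, 0 < k → k < 11 → k • Point.some 0 0 h0 ≠ 0 := fun k hk hk' h => by
    have := Nat.le_of_dvd hk (addOrderOf_dvd_of_nsmul_eq_zero h)
    omega
  have h2 := Point.add_self_of_Y_ne (h₁ := h0) hy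
  rcases Point.X_eq_iff (h₁ := nonsingular_add h0 h0 fun hxy => hy hxy.right) (h₂ := h0).1 hx
    with h1 | h1
  · rw [← h2] at h1
    exact Point.some_ne_zero h0 (add_eq_left.1 h1)
  · rw [← h2] at h1
    apply key 3 (by norm_num) (by norm_num)
    rw [succ_nsmul, two_nsmul, h1, neg_add_cancel]

/-- The remaining scaling by `u = a₃'/a₂'` makes `a₂` and `a₃` equal; their common value is `-b`. -/
theorem exists_smul_eq_tateCurve (A : TorsionPair 11 K) :
    ∃ c : VariableChange K, c • A.W = tateCurve A.tateB A.tateC ∧ c.r = A.x ∧ c.t = A.y := by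
  have h3 := A.a₃'_ne_zero
  have h2 := A.a₂'_ne_zero
  let u : Kˣ := Units.mk0 (A.a₃' / A.a₂') (div_ne_zero h3 h2)
  refine ⟨⟨u, 0, 0, 0⟩ * ⟨1, A.x, A.slope', A.y⟩, ?_, ?_, ?_⟩
  · rw [mul_smul, smul_eq_of_u_eq_one, variableChange_def]
    ext <;> simp only [u, tateCurve, tateB, tateC, Units.val_inv_eq_inv_val, Units.val_mk0]
    · field_simp; ring
    · field_simp; ring
    · field_simp; ring
    · ring
    · ring
  · simp [VariableChange.mul_def]
  · simp [VariableChange.mul_def]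

/-- The pair given by a Tate normal form. -/
def ofTate (b c : K) (hΔ : (tateCurve b c).Δ ≠ 0)
    (h : ∀ h0 : (tateCurve b c).toAffine.Nonsingular 0 0, addOrderOf (Point.some 0 0 h0) = N) :
    TorsionPair N K where
  W := tateCurve b c
  elliptic := ⟨isUnit_iff_ne_zero.2 hΔ⟩
  x := 0
  y := 0
  nonsingular := (equation_iff_nonsingular_of_Δ_ne_zero hΔ).1 (tateCurve_equation_zero b c)
  order := h _

theorem tateB_ofTate {b c : K} (hΔ : (tateCurve b c).Δ ≠ 0)
    (h : ∀ h0 : (tateCurve b c).toAffine.Nonsingular 0 0, addOrderOf (Point.some 0 0 h0) = N) :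
    (ofTate b c hΔ h).tateB = b := by
  have := ne_zero_of_tateCurve_Δ_ne_zero hΔ
  simp [tateB, a₂', a₃', slope', ofTate, tateCurve]
  field_simp

theorem tateC_ofTate {b c : K} (hΔ : (tateCurve b c).Δ ≠ 0)
    (h : ∀ h0 : (tateCurve b c).toAffine.Nonsingular 0 0, addOrderOf (Point.some 0 0 h0) = N) :
    (ofTate b c hΔ h).tateC = c := by
  have := ne_zero_of_tateCurve_Δ_ne_zero hΔ
  simp [tateC, a₂', a₃', slope', ofTate, tateCurve]
  field_simp
  ring

/-- The Tate normal form of a point of order `11`. -/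
theorem exists_tate (A : TorsionPair 11 K) : ∃ (hΔ : (tateCurve A.tateB A.tateC).Δ ≠ 0)
    (h : ∀ h0 : (tateCurve A.tateB A.tateC).toAffine.Nonsingular 0 0,
      addOrderOf (Point.some 0 0 h0) = 11), A.Iso (ofTate A.tateB A.tateC hΔ h) := by
  obtain ⟨c, hc, hr, ht⟩ := A.exists_smul_eq_tateCurve
  have := A.elliptic
  have hΔ : (tateCurve A.tateB A.tateC).Δ ≠ 0 := by
    rw [← hc]; exact (c • A.W).isUnit_Δ.ne_zero
  refine ⟨hΔ, fun h0 => ?_, c, hc, by simp [ofTate, hr], by simp [ofTate, ht]⟩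
  rw [addOrderOf_variableChange hc A.nonsingular h0 (by simp [hr]) (by simp [ht]), A.order]

/-- Fixing the origin gives `r = t = 0`, then `a₄ = 0` forces `s = 0`, and `a₂ = a₃ = -b ≠ 0` forces
`u = 1`. -/
theorem ofTate_iso_iff {b c b' c' : K} {hΔ : (tateCurve b c).Δ ≠ 0}
    {h : ∀ h0 : (tateCurve b c).toAffine.Nonsingular 0 0, addOrderOf (Point.some 0 0 h0) = N}
    {hΔ' : (tateCurve b' c').Δ ≠ 0}
    {h' : ∀ h0 : (tateCurve b' c').toAffine.Nonsingular 0 0, addOrderOf (Point.some 0 0 h0) = N} :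
    (ofTate b c hΔ h).Iso (ofTate b' c' hΔ' h') ↔ b = b' ∧ c = c' := by
  constructor
  · rintro ⟨C, hC, hx, hy⟩
    have hu : (C.u : K) ≠ 0 := C.u.ne_zero
    have hb := ne_zero_of_tateCurve_Δ_ne_zero hΔ
    have hr : C.r = 0 := by simpa [ofTate] using hx.symm
    have ht : C.t = 0 := by simpa [ofTate] using hy.symm
    have e1 := congrArg WeierstrassCurve.a₁ hC
    have e2 := congrArg WeierstrassCurve.a₂ hC
    have e3 := congrArg WeierstrassCurve.a₃ hC
    have e4 := congrArg WeierstrassCurve.a₄ hC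
    simp only [variableChange_def, ofTate, tateCurve, hr, ht, Units.val_inv_eq_inv_val] at e1 e2 e3 e4
    have hs : C.s = 0 := by
      have : ((C.u : K)⁻¹ ^ 4 * b) * C.s = 0 := by linear_combination e4
      exact (mul_eq_zero.1 this).resolve_left (mul_ne_zero (pow_ne_zero _ (inv_ne_zero hu)) hb)
    rw [hs] at e1 e2
    have hu1 : (C.u : K) = 1 := by
      have h23 : ((C.u : K)⁻¹ ^ 2 * b) * (C.u : K)⁻¹ = ((C.u : K)⁻¹ ^ 2 * b) * 1 := by
        linear_combination e2 - e3
      exact inv_eq_one.1 (mul_left_cancel₀ (mul_ne_zero (pow_ne_zero _ (inv_ne_zero hu)) hb) h23)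
    rw [hu1] at e1 e2
    constructor
    · linear_combination -e2
    · linear_combination -e1
  · rintro ⟨rfl, rfl⟩
    exact ⟨1, one_smul _ _, by simp [ofTate, VariableChange.one_def],
      by simp [ofTate, VariableChange.one_def]⟩

theorem iso_iff (A B : TorsionPair 11 K) :
    A.Iso B ↔ A.tateB = B.tateB ∧ A.tateC = B.tateC := by
  obtain ⟨hΔ, h, hA⟩ := A.exists_tate
  obtain ⟨hΔ', h', hB⟩ := B.exists_tate
  rw [← ofTate_iso_iff (hΔ := hΔ) (h := h) (hΔ' := hΔ') (h' := h')]
  exact ⟨fun hAB => hA.symm.trans (hAB.trans hB), fun hAB => hA.trans (hAB.trans hB.symm)⟩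

end TorsionPair

/-! ### Values of polynomials with rational coefficients -/

section EvalAt

variable {K : Type*} [Field K] [CharZero K]

/-- Evaluation at a point over a field of characteristic zero, as a ring homomorphism. -/
noncomputable def evalAtHom (x y : K) : ℚ[X][Y] →+* K :=
  (evalEvalRingHom x y).comp (mapRingHom (mapRingHom (algebraMap ℚ K)))

theorem evalAt_eq (f : ℚ[X][Y]) (x y : K) : evalAt f x y = evalAtHom x y f := rfl

@[simp] theorem evalAtHom_C_X (x y : K) : evalAtHom x y (C X) = x := by
  simp [evalAtHom]

@[simp] theorem evalAtHom_Y (x y : K) : evalAtHom x y Y = y := by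
  simp [evalAtHom]

theorem evalAt_elkiesCubic (x y : K) :
    evalAt elkiesCubic x y = 2 * y ^ 2 - (x ^ 3 + x ^ 2 - x + 1) := by
  simp [evalAt_eq, elkiesCubic, map_ofNat]

theorem evalAt_weierstrassCubic (x y : K) :
    evalAt weierstrassCubic x y = y ^ 2 + y - (x ^ 3 - x ^ 2) := by
  simp [evalAt_eq, weierstrassCubic]

end EvalAt

/-! ### The modular curve `X₁(11)` -/

section ModularCurve

theorem irreducible_weierstrassCubic : Irreducible weierstrassCubic := by
  have := WeierstrassCurve.Affine.irreducible_polynomial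
    (W := (⟨0, -1, 1, 0, 0⟩ : WeierstrassCurve ℚ).toAffine)
  convert this using 1
  simp [weierstrassCubic, WeierstrassCurve.Affine.polynomial]
  ring

/-- The numerator of the discriminant of the elliptic curve over a point `(u, v)` of `X₁(11)`. -/
def modularDiscriminant {R : Type*} [CommRing R] (u v : R) : R :=
  16 * ((1 + v) * v * (u + v)) ^ 2 * u ^ 2
    - 8 * ((1 + v) * v * (u + v)) * (v * (u + v)) ^ 2 * u
    - 20 * ((1 + v) * v * (u + v)) * (v * (u + v)) * u ^ 2
    + ((1 + v) * v * (u + v)) * u ^ 3 + (v * (u + v)) ^ 4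
    - 3 * (v * (u + v)) ^ 3 * u + 3 * (v * (u + v)) ^ 2 * u ^ 2 - v * (u + v) * u ^ 3

/-- The polynomial whose zeros on `y² + y = x³ - x²` are the cusps of `X₁(11)`. -/
noncomputable def cuspPolynomial : ℚ[X][Y] :=
  C X * Y * (1 + Y) * (C X + Y) * modularDiscriminant (C X) (Y : ℚ[X][Y])

theorem map_modularDiscriminant {R S : Type*} [CommRing R] [CommRing S] (φ : R →+* S) (u v : R) :
    φ (modularDiscriminant u v) = modularDiscriminant (φ u) (φ v) := by
  simp [modularDiscriminant, map_ofNat]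

theorem evalAt_cuspPolynomial {K : Type*} [Field K] [CharZero K] (x y : K) :
    evalAt cuspPolynomial x y = x * y * (1 + y) * (x + y) * modularDiscriminant x y := by
  simp [evalAt_eq, cuspPolynomial, map_modularDiscriminant]

/-- One point of the cubic where the other polynomial does not vanish suffices; `x = 2`, `v = (√17 -
1)/2` is such a point. -/
theorem not_weierstrassCubic_dvd_cuspPolynomial : ¬ weierstrassCubic ∣ cuspPolynomial := by
  intro h
  obtain ⟨v, hv0, hv⟩ : ∃ v : ℝ, 0 < v ∧ v ^ 2 = 4 - v := by
    have h17 : √17 ^ 2 = (17 : ℝ) := Real.sq_sqrt (by norm_num)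
    have h1 : 1 < √(17 : ℝ) := Real.lt_sqrt_of_sq_lt (by norm_num)
    exact ⟨(√17 - 1) / 2, by linarith, by linear_combination h17 / 4⟩
  have h0 : evalAt cuspPolynomial 2 v = 0 := by
    obtain ⟨g, hg⟩ := h
    rw [hg, evalAt_eq, map_mul, ← evalAt_eq, evalAt_weierstrassCubic]
    linear_combination (evalAtHom 2 v g) * hv
  have hD : modularDiscriminant 2 v = 220 - 163 * v := by
    have h1 : (1 + v) * v * (2 + v) = 8 + 4 * v := by linear_combination (2 + v) * hv
    have h2 : v * (2 + v) = v + 4 := by linear_combination hv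
    rw [modularDiscriminant, h1, h2]
    linear_combination (v ^ 2 - 55 * v + 159) * hv
  rw [evalAt_cuspPolynomial, hD] at h0
  have : 220 - 163 * v = 0 := (mul_eq_zero.1 h0).resolve_left (by positivity)
  have hv' : v = 220 / 163 := by linarith
  rw [hv'] at hv
  norm_num at hv

theorem modularDiscriminant_eq {K : Type*} [Field K] {u v : K} (hu : u ≠ 0) :
    modularDiscriminant u v = u ^ 4 *
      (16 * ((1 + v) * v * (u + v) / u) ^ 2
        - 8 * ((1 + v) * v * (u + v) / u) * (v * (u + v) / u) ^ 2
        - 20 * ((1 + v) * v * (u + v) / u) * (v * (u + v) / u) + ((1 + v) * v * (u + v) / u)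
        + (v * (u + v) / u) ^ 4 - 3 * (v * (u + v) / u) ^ 3 + 3 * (v * (u + v) / u) ^ 2
        - v * (u + v) / u) := by
  rw [modularDiscriminant]
  field_simp

theorem tateCurve_Δ_ne_zero_iff {K : Type*} [Field K] {u v : K} (hu : u ≠ 0) (hv : v ≠ 0)
    (hv' : 1 + v ≠ 0) (huv : u + v ≠ 0) :
    (WeierstrassCurve.tateCurve ((1 + v) * v * (u + v) / u) (v * (u + v) / u)).Δ ≠ 0 ↔
      modularDiscriminant u v ≠ 0 := by
  rw [WeierstrassCurve.tateCurve_Δ, modularDiscriminant_eq hu, mul_ne_zero_iff, mul_ne_zero_iff]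
  simp [hu, hv, hv', huv]

namespace TorsionPair

open WeierstrassCurve WeierstrassCurve.Affine

/-- The point of `y² + y = x³ - x²` that corresponds to a pair `(E, P)`. -/
def toX1Eleven {K : Type*} [Field K] [DecidableEq K] (A : TorsionPair 11 K) : K × K :=
  let v := A.tateB / A.tateC - 1
  (v / (A.tateC / v - 1), v)

variable {K : Type*} [Field K] [DecidableEq K]

/-- In terms of the Tate parameters, `v = r - 1` and `u = (r - 1)/(s - 1)`, so that `s = (u + v)/u`.
-/
theorem toX1Eleven_spec (A : TorsionPair 11 K) : ∃ u v : K, A.toX1Eleven = (u, v) ∧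
    u ≠ 0 ∧ v ≠ 0 ∧ 1 + v ≠ 0 ∧ u + v ≠ 0 ∧ v ^ 2 + v = u ^ 3 - u ^ 2 ∧
    A.tateB = (1 + v) * v * (u + v) / u ∧ A.tateC = v * (u + v) / u := by
  obtain ⟨hΔ, h, -⟩ := A.exists_tate
  obtain ⟨r, s, hr, hr1, hs, hs1, hb, hc, e⟩ := exists_tate_parameters
    ((equation_iff_nonsingular_of_Δ_ne_zero hΔ).1 (tateCurve_equation_zero _ _)) (h _)
  have hv : A.tateB / A.tateC - 1 = r - 1 := by
    rw [hb, hc]; field_simp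
  have hu : A.tateC / (r - 1) - 1 = s - 1 := by
    rw [hc]; field_simp
  refine ⟨(r - 1) / (s - 1), r - 1, by simp only [toX1Eleven, hv, hu], div_ne_zero hr1 hs1, hr1,
    by simpa using hr, ?_, ?_, ?_, ?_⟩
  · have : (r - 1) / (s - 1) + (r - 1) = s * ((r - 1) / (s - 1)) := by field_simp; ring
    rw [this]
    exact mul_ne_zero hs (div_ne_zero hr1 hs1)
  · field_simp
    linear_combination e
  · rw [hb]; field_simp; ring
  · rw [hc]; field_simp; ring

theorem toX1Eleven_eq_iff (A B : TorsionPair 11 K) : A.toX1Eleven = B.toX1Eleven ↔ A.Iso B := by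
  rw [iso_iff]
  constructor
  · intro h
    obtain ⟨u, v, hA, -, -, -, -, -, hb, hc⟩ := A.toX1Eleven_spec
    obtain ⟨u', v', hB, -, -, -, -, -, hb', hc'⟩ := B.toX1Eleven_spec
    rw [hA, hB, Prod.mk.injEq] at h
    rw [hb, hc, hb', hc', h.1, h.2]
    exact ⟨rfl, rfl⟩
  · rintro ⟨hb, hc⟩
    simp only [toX1Eleven, hb, hc]

theorem exists_toX1Eleven_eq_iff [CharZero K] (x y : K) :
    (∃ A : TorsionPair 11 K, A.toX1Eleven = (x, y)) ↔
      evalAt weierstrassCubic x y = 0 ∧ evalAt cuspPolynomial x y ≠ 0 := by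
  rw [evalAt_weierstrassCubic, evalAt_cuspPolynomial, sub_eq_zero]
  simp only [mul_ne_zero_iff]
  constructor
  · rintro ⟨A, hA⟩
    obtain ⟨u, v, hA', hu, hv, hv', huv, e, hb, hc⟩ := A.toX1Eleven_spec
    rw [hA', Prod.mk.injEq] at hA
    obtain ⟨rfl, rfl⟩ := hA
    obtain ⟨hΔ, -, -⟩ := A.exists_tate
    rw [hb, hc] at hΔ
    exact ⟨e, ⟨⟨⟨hu, hv⟩, hv'⟩, huv⟩, (tateCurve_Δ_ne_zero_iff hu hv hv' huv).1 hΔ⟩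
  · rintro ⟨e, ⟨⟨⟨hx, hy⟩, hy'⟩, hxy⟩, hD⟩
    have hΔ := (tateCurve_Δ_ne_zero_iff hx hy hy' hxy).2 hD
    have hb : (1 + y) * y * (x + y) / x = (1 + y) * ((x + y) / x * (1 + y - 1)) := by
      field_simp; ring
    have hc : y * (x + y) / x = (x + y) / x * (1 + y - 1) := by field_simp; ring
    have hs1 : (x + y) / x - 1 = y / x := by field_simp; ring
    have hr1 : 1 + y - 1 = y := by ring
    have hord : ∀ h0 : (tateCurve ((1 + y) * y * (x + y) / x) (y * (x + y) / x)).toAffine.Nonsingular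
        0 0, addOrderOf (Point.some 0 0 h0) = 11 := by
      rw [hb, hc]
      intro h0
      refine tateCurve_addOrderOf_eq_eleven hy' (by rwa [hr1]) (div_ne_zero hxy hx)
        (by rw [hs1]; exact div_ne_zero hy hx) h0 ?_
      rw [hs1]
      field_simp
      linear_combination y ^ 2 * e
    refine ⟨ofTate _ _ hΔ hord, ?_⟩
    have hv : (1 + y) * y * (x + y) / x / (y * (x + y) / x) - 1 = y := by field_simp; ring
    have hu : y / (y * (x + y) / x / y - 1) = x := by
      rw [mul_div_assoc, mul_div_cancel_left₀ _ hy, hs1]; field_simp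
    simp only [toX1Eleven, tateB_ofTate, tateC_ofTate, hv, hu]

/-- Every ingredient is a rational expression in the coefficients and the point, and field
homomorphisms respect division. -/
theorem toX1Eleven_of_isBaseChange {L : Type*} [Field L] [DecidableEq L] {σ : K →+* L}
    {A : TorsionPair 11 K} {B : TorsionPair 11 L} (h : A.IsBaseChange σ B) :
    B.toX1Eleven = (σ A.toX1Eleven.1, σ A.toX1Eleven.2) := by
  obtain ⟨hW, hx, hy⟩ := h
  have h3 : B.a₃' = σ A.a₃' := by simp [a₃', hW, hx, hy, map_ofNat]
  have hs : B.slope' = σ A.slope' := by simp [slope', h3, hW, hx, hy, map_ofNat]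
  have h2 : B.a₂' = σ A.a₂' := by simp [a₂', hs, hW, hx, map_ofNat]
  have hb : B.tateB = σ A.tateB := by simp [tateB, h2, h3]
  have hc : B.tateC = σ A.tateC := by simp [tateC, h2, h3, hs, hW, map_ofNat]
  simp [toX1Eleven, hb, hc]

end TorsionPair

theorem isModelOfX1_weierstrassCubic.{u} : IsModelOfX1.{u} 11 weierstrassCubic :=
  ⟨irreducible_weierstrassCubic, cuspPolynomial, fun _ _ _ _ A => A.toX1Eleven,
    not_weierstrassCubic_dvd_cuspPolynomial,
    fun _ _ _ _ => ⟨TorsionPair.toX1Eleven_eq_iff, TorsionPair.exists_toX1Eleven_eq_iff⟩,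
    fun _ _ _ _ _ _ _ _ _ _ _ h => TorsionPair.toX1Eleven_of_isBaseChange h⟩

end ModularCurve

/-! ### The change of coordinates between the two cubics -/

section Birational

/-- The automorphism of `ℚ[x, y]` with `x ↦ 2 x - 1` and `y ↦ 2 y + 1`. -/
noncomputable def coordinateChange : ℚ[X][Y] ≃ₐ[ℚ] ℚ[X][Y] :=
  letI : Invertible (2 : ℚ) := invertibleOfNonzero two_ne_zero
  letI : Invertible (2 : ℚ[X]) := ⟨C (1 / 2), by
    rw [← map_ofNat C, ← C_mul]; norm_num, by rw [← map_ofNat C, ← C_mul]; norm_num⟩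
  (mapAlgEquiv (algEquivCMulXAddC (2 : ℚ) (-1))).trans
    ((algEquivCMulXAddC (2 : ℚ[X]) 1).restrictScalars ℚ)

theorem coordinateChange_elkiesCubic :
    coordinateChange elkiesCubic = C (C 8) * weierstrassCubic := by
  simp only [coordinateChange, elkiesCubic, weierstrassCubic, AlgEquiv.trans_apply]
  simp [map_ofNat]
  ring

theorem isUnit_C_C_eight : IsUnit (C (C 8) : ℚ[X][Y]) := by
  simp

theorem irreducible_elkiesCubic : Irreducible elkiesCubic := by
  rw [← MulEquiv.irreducible_iff coordinateChange, coordinateChange_elkiesCubic,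
    irreducible_isUnit_mul isUnit_C_C_eight]
  exact irreducible_weierstrassCubic

/-- The isomorphism of the coordinate rings of the two cubics. -/
noncomputable def coordinateRingEquiv :
    AdjoinRoot elkiesCubic ≃ₐ[ℚ] AdjoinRoot weierstrassCubic :=
  Ideal.quotientEquivAlg (Ideal.span {elkiesCubic}) (Ideal.span {weierstrassCubic})
    coordinateChange (by
      rw [Ideal.map_span, Set.image_singleton]
      erw [coordinateChange_elkiesCubic]
      rw [Ideal.span_singleton_mul_left_unit isUnit_C_C_eight])

theorem birationallyEquivalent_elkiesCubic_weierstrassCubic :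
    BirationallyEquivalent elkiesCubic weierstrassCubic := by
  refine ⟨irreducible_elkiesCubic, irreducible_weierstrassCubic, ⟨?_⟩⟩
  exact IsFractionRing.algEquivOfAlgEquiv coordinateRingEquiv

end Birational

/-! ### Collinearity and determinants -/

section Collinearity

/-- The determinant of three vectors. -/
def det₃ {R : Type*} [CommRing R] (u v w : Fin 3 → R) : R := (Matrix.of ![u, v, w]).det

theorem det₃_eq {R : Type*} [CommRing R] (u v w : Fin 3 → R) : det₃ u v w =
    u 0 * v 1 * w 2 - u 0 * v 2 * w 1 - u 1 * v 0 * w 2 + u 1 * v 2 * w 0 + u 2 * v 0 * w 1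
      - u 2 * v 1 * w 0 := by
  simp [det₃, Matrix.det_fin_three]

theorem det₃_smul {R : Type*} [CommRing R] (a b c : R) (u v w : Fin 3 → R) :
    det₃ (a • u) (b • v) (c • w) = a * b * c * det₃ u v w := by
  simp only [det₃_eq, Pi.smul_apply, smul_eq_mul]
  ring

theorem map_det₃ {R S : Type*} [CommRing R] [CommRing S] (φ : R →+* S) (u v w : Fin 3 → R) :
    φ (det₃ u v w) = det₃ (fun t => φ (u t)) (fun t => φ (v t)) (fun t => φ (w t)) := by
  simp [det₃_eq]

variable {K : Type*} [Field K]

theorem linearIndependent_iff_det₃_ne_zero {u v w : Fin 3 → K} :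
    LinearIndependent K ![u, v, w] ↔ det₃ u v w ≠ 0 := by
  rw [det₃, ← isUnit_iff_ne_zero, ← Matrix.isUnit_iff_isUnit_det,
    ← Matrix.linearIndependent_rows_iff_isUnit]
  rfl

theorem projectivelyCollinear_iff {u v w : Fin 3 → K} (hu : u ≠ 0) (hv : v ≠ 0) (hw : w ≠ 0) :
    ProjectivelyCollinear {Projectivization.mk K u hu, Projectivization.mk K v hv,
      Projectivization.mk K w hw} ↔ det₃ u v w = 0 := by
  rw [det₃, ← Matrix.exists_mulVec_eq_zero_iff]
  have key : ∀ ℓ : Fin 3 → K, (Matrix.of ![u, v, w]).mulVec ℓ = 0 ↔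
      ℓ ⬝ᵥ u = 0 ∧ ℓ ⬝ᵥ v = 0 ∧ ℓ ⬝ᵥ w = 0 := by
    intro ℓ
    simp [funext_iff, Fin.forall_fin_succ, dotProduct_comm ℓ]
  constructor
  · rintro ⟨ℓ, h⟩
    induction ℓ using Projectivization.ind with
    | h ℓ hℓ =>
      refine ⟨ℓ, hℓ, (key ℓ).2 ?_⟩
      simpa [Projectivization.orthogonal_mk] using h
  · rintro ⟨ℓ, hℓ, h⟩
    refine ⟨Projectivization.mk K ℓ hℓ, ?_⟩
    simpa [Projectivization.orthogonal_mk] using (key ℓ).1 h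

theorem collinear_iff_det₃_eq_zero (p q r : Fin 2 → K) : Collinear K ({p, q, r} : Set (Fin 2 → K)) ↔
    det₃ ![p 0, p 1, 1] ![q 0, q 1, 1] ![r 0, r 1, 1] = 0 := by
  rw [collinear_iff_of_mem (p₀ := p) (by simp), det₃_eq]
  simp only [Set.mem_insert_iff, Set.mem_singleton_iff, forall_eq_or_imp, forall_eq]
  simp only [vadd_eq_add, funext_iff, Fin.forall_fin_two, Pi.add_apply, Pi.smul_apply, smul_eq_mul,
    Matrix.cons_val_zero, Matrix.cons_val_one, Matrix.cons_val]
  constructor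
  · rintro ⟨v, -, ⟨s, hs0, hs1⟩, t, ht0, ht1⟩
    rw [hs0, hs1, ht0, ht1]
    ring
  · intro h
    by_cases h0 : q 0 = p 0
    · by_cases h1 : q 1 = p 1
      · exact ⟨r - p, ⟨0, by simp, by simp⟩, ⟨0, by simp [h0], by simp [h1]⟩, 1, by simp, by simp⟩
      · have h1' : q 1 - p 1 ≠ 0 := sub_ne_zero.2 h1
        refine ⟨q - p, ⟨0, by simp, by simp⟩, ⟨1, by simp, by simp⟩,
          (r 1 - p 1) / (q 1 - p 1), ?_, ?_⟩
        · simp only [Pi.sub_apply]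
          field_simp
          rw [h0] at h ⊢
          linear_combination -h
        · simp only [Pi.sub_apply]
          field_simp
          ring
    · have h0' : q 0 - p 0 ≠ 0 := sub_ne_zero.2 h0
      refine ⟨q - p, ⟨0, by simp, by simp⟩, ⟨1, by simp, by simp⟩,
        (r 0 - p 0) / (q 0 - p 0), ?_, ?_⟩
      · simp only [Pi.sub_apply]
        field_simp
        ring
      · simp only [Pi.sub_apply]
        field_simp
        linear_combination h

end Collinearity

/-! ### Realizations -/

section Realizations

variable {K ι : Type*} [Field K] [DecidableEq ι] {T : Finset (Finset ι)}

theorem affinePoint_injective {x y x' y' : K} (h : affinePoint x y = affinePoint x' y') :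
    x = x' ∧ y = y' := by
  obtain ⟨a, ha⟩ := (Projectivization.mk_eq_mk_iff' ..).1 h
  have h2 := congrFun ha 2
  have h0 := congrFun ha 0
  have h1 := congrFun ha 1
  simp at h0 h1 h2
  simp_all

theorem IsAffineRealization.projective {p : ι → Fin 2 → K} (h : IsAffineRealization T p) :
    IsProjectiveRealization T fun i => affinePoint (p i 0) (p i 1) := by
  refine ⟨fun i j hij => h.1 ?_, fun i j k hij hik hjk => ?_⟩
  · obtain ⟨h0, h1⟩ := affinePoint_injective hij
    ext t
    fin_cases t <;> assumption
  · rw [← h.2 i j k hij hik hjk, collinear_iff_det₃_eq_zero]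
    exact projectivelyCollinear_iff _ _ _

theorem IsProjectiveRealization.det₃_eq_zero_iff {q : ι → ℙ K (Fin 3 → K)}
    (h : IsProjectiveRealization T q) {w : ι → Fin 3 → K}
    (hw : ∀ i, ∃ h : w i ≠ 0, q i = Projectivization.mk K (w i) h) {i j k : ι} (hij : i ≠ j)
    (hik : i ≠ k) (hjk : j ≠ k) : det₃ (w i) (w j) (w k) = 0 ↔ ({i, j, k} : Finset ι) ∈ T := by
  rw [← h.2 i j k hij hik hjk]
  obtain ⟨hi, ei⟩ := hw i
  obtain ⟨hj, ej⟩ := hw j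
  obtain ⟨hk, ek⟩ := hw k
  rw [ei, ej, ek, projectivelyCollinear_iff]

theorem IsProjectiveRealization.projectivity {q : ι → ℙ K (Fin 3 → K)}
    (h : IsProjectiveRealization T q) (S : (Fin 3 → K) ≃ₗ[K] (Fin 3 → K)) :
    IsProjectiveRealization T fun i => projectivity S (q i) := by
  refine ⟨(Projectivization.map_injective _ S.injective).comp h.1, fun i j k hij hik hjk => ?_⟩
  rw [← h.2 i j k hij hik hjk]
  have key : ∀ P Q R : ℙ K (Fin 3 → K), ProjectivelyCollinear
      {_root_.projectivity S P, _root_.projectivity S Q, _root_.projectivity S R} ↔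
      ProjectivelyCollinear {P, Q, R} := by
    intro P Q R
    induction P using Projectivization.ind with | h u hu =>
    induction Q using Projectivization.ind with | h v hv =>
    induction R using Projectivization.ind with | h w hw =>
    simp only [_root_.projectivity, Projectivization.map_mk]
    rw [projectivelyCollinear_iff, projectivelyCollinear_iff, ← not_iff_not, ← ne_eq, ← ne_eq,
      ← linearIndependent_iff_det₃_ne_zero, ← linearIndependent_iff_det₃_ne_zero,
      ← LinearMap.linearIndependent_iff (S : (Fin 3 → K) →ₗ[K] (Fin 3 → K)) S.ker (v := ![u, v, w])]
    congr! 1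
    ext i t
    fin_cases i <;> rfl
  exact key _ _ _

end Realizations

/-! ### The eleven triples -/

section Triples

/-- The eleven triples, as lists. -/
def elkiesLines : List (List (Fin 10)) :=
  [[1, 5, 0], [3, 5, 8], [4, 5, 7], [2, 5, 9], [1, 3, 7], [4, 8, 0], [1, 2, 8], [3, 9, 0],
    [1, 4, 6], [2, 3, 6], [6, 7, 9]]

theorem elkiesTriples_eq : elkiesTriples = elkiesLines.toFinset.image List.toFinset := by
  ext S
  simp only [elkiesTriples, elkiesLines, Finset.mem_insert, Finset.mem_singleton, Finset.mem_image,
    exists_eq_or_imp, exists_eq_left,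
    List.toFinset_cons, List.toFinset_nil, insert_empty_eq, eq_comm (b := S)]

theorem triple_eq_iff {α : Type*} [DecidableEq α] {i j k a b c : α} (hij : i ≠ j) (hik : i ≠ k)
    (hjk : j ≠ k) : ({i, j, k} : Finset α) = {a, b, c} ↔
      i ∈ [a, b, c] ∧ j ∈ [a, b, c] ∧ k ∈ [a, b, c] := by
  have h3 : ({a, b, c} : Finset α).card ≤ ({i, j, k} : Finset α).card := by
    rw [Finset.card_eq_three.2 ⟨i, j, k, hij, hik, hjk, rfl⟩]
    exact Finset.card_le_three
  rw [← Finset.subset_iff_eq_of_card_le h3]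
  simp [Finset.insert_subset_iff]

/-- The list form on the right is what `decide` evaluates. -/
theorem triple_mem_elkiesTriples_iff {i j k : Fin 10} (hij : i ≠ j) (hik : i ≠ k) (hjk : j ≠ k) :
    ({i, j, k} : Finset (Fin 10)) ∈ elkiesTriples ↔ ∃ t ∈ elkiesLines, i ∈ t ∧ j ∈ t ∧ k ∈ t := by
  simp only [elkiesTriples, elkiesLines, Finset.mem_insert, Finset.mem_singleton,
    triple_eq_iff hij hik hjk, List.mem_cons, exists_eq_or_imp, List.not_mem_nil,
    or_false, exists_eq_left]

theorem card_eq_three_of_mem_elkiesTriples {S : Finset (Fin 10)} (hS : S ∈ elkiesTriples) :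
    S.card = 3 := by
  rw [elkiesTriples_eq, Finset.mem_image] at hS
  obtain ⟨t, ht, rfl⟩ := hS
  have h : ∀ t ∈ elkiesLines, t.Nodup ∧ t.length = 3 := by decide
  rw [List.mem_toFinset] at ht
  rw [List.toFinset_card_of_nodup (h t ht).1, (h t ht).2]

theorem card_inter_le_one_of_mem_elkiesLines {t t' : List (Fin 10)} (ht : t ∈ elkiesLines)
    (ht' : t' ∈ elkiesLines) (h : t ≠ t') : (t.toFinset ∩ t'.toFinset).card ≤ 1 := by
  have key : elkiesLines.Pairwise fun t t' => (t.filter (· ∈ t')).length ≤ 1 := by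
    decide +kernel
  let R : List (Fin 10) → List (Fin 10) → Prop := fun t t' => (t.toFinset ∩ t'.toFinset).card ≤ 1
  have : Std.Symm R := ⟨fun t t' h => by simpa only [R, Finset.inter_comm] using h⟩
  refine (key.imp (S := R) fun {t t'} h => ?_).forall ht ht' h
  have e : t.toFinset ∩ t'.toFinset = (t.filter (· ∈ t')).toFinset := by ext; simp
  simp only [R, e]
  exact (List.toFinset_card_le _).trans h

theorem card_inter_le_one_of_mem_elkiesTriples {S S' : Finset (Fin 10)} (hS : S ∈ elkiesTriples)
    (hS' : S' ∈ elkiesTriples) (h : S ≠ S') : (S ∩ S').card ≤ 1 := by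
  rw [elkiesTriples_eq, Finset.mem_image] at hS hS'
  obtain ⟨t, ht, rfl⟩ := hS
  obtain ⟨t', ht', rfl⟩ := hS'
  rw [List.mem_toFinset] at ht ht'
  exact card_inter_le_one_of_mem_elkiesLines ht ht' fun e => h (by rw [e])

theorem card_elkiesTriples : elkiesTriples.card = 11 := by
  rw [elkiesTriples_eq, Finset.card_image_of_injOn, List.toFinset_card_of_nodup (by decide)]
  · rfl
  · intro t ht t' ht' e
    by_contra hne
    rw [Finset.mem_coe, List.mem_toFinset] at ht ht'
    have h1 := card_inter_le_one_of_mem_elkiesLines ht ht' hne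
    have h3 := card_eq_three_of_mem_elkiesTriples (S := t.toFinset) (by
      rw [elkiesTriples_eq]; exact Finset.mem_image_of_mem _ (List.mem_toFinset.2 ht))
    rw [← e, Finset.inter_self, h3] at h1
    omega

end Triples

/-! ### Normalisation of a realization -/

section Normalisation

variable {K : Type*} [Field K]

theorem exists_linearEquiv_apply_eq {u u' : Fin 3 → Fin 3 → K} (hu : LinearIndependent K u)
    (hu' : LinearIndependent K u') :
    ∃ S : (Fin 3 → K) ≃ₗ[K] (Fin 3 → K), ∀ i, S (u i) = u' i := by
  let b := basisOfLinearIndependentOfCardEqFinrank hu (by simp)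
  let b' := basisOfLinearIndependentOfCardEqFinrank hu' (by simp)
  refine ⟨b.equiv b' (Equiv.refl _), fun i => ?_⟩
  have := b.equiv_apply i b' (Equiv.refl _)
  simpa [b, b'] using this

theorem cramer_det₃ (u v w x : Fin 3 → K) : det₃ u v w • x =
    det₃ x v w • u + det₃ u x w • v + det₃ u v x • w := by
  ext t
  simp only [det₃_eq, Pi.add_apply, Pi.smul_apply, smul_eq_mul]
  fin_cases t <;> simp <;> ring

theorem projectivity_mk_eq {S : (Fin 3 → K) ≃ₗ[K] (Fin 3 → K)} {v w : Fin 3 → K} {hv : v ≠ 0}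
    {hw : w ≠ 0} {k : K} (h : S v = k • w) :
    projectivity S (Projectivization.mk K v hv) = Projectivization.mk K w hw := by
  rw [projectivity, Projectivization.map_mk, Projectivization.mk_eq_mk_iff']
  exact ⟨k, h.symm⟩

/-- Four points, no three of which are collinear, are sent to the vertices of a square. -/
theorem exists_projectivity_square [NeZero (2 : K)] {P₁ P₂ P₃ P₄ : ℙ K (Fin 3 → K)}
    (h₁ : ¬ ProjectivelyCollinear {P₄, P₂, P₃}) (h₂ : ¬ ProjectivelyCollinear {P₁, P₄, P₃})
    (h₃ : ¬ ProjectivelyCollinear {P₁, P₂, P₄}) (h₄ : ¬ ProjectivelyCollinear {P₁, P₂, P₃}) :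
    ∃ S : (Fin 3 → K) ≃ₗ[K] (Fin 3 → K), projectivity S P₁ = affinePoint 1 1 ∧
      projectivity S P₂ = affinePoint 1 (-1) ∧ projectivity S P₃ = affinePoint (-1) 1 ∧
      projectivity S P₄ = affinePoint (-1) (-1) := by
  induction P₁ using Projectivization.ind with | h u hu =>
  induction P₂ using Projectivization.ind with | h v hv =>
  induction P₃ using Projectivization.ind with | h w hw =>
  induction P₄ using Projectivization.ind with | h x hx =>
  rw [projectivelyCollinear_iff] at h₁ h₂ h₃ h₄
  -- By Cramer's rule the three scaled vectors add up to a multiple of `x`. The targets are scaled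
  -- likewise: `-(1, 1, 1) + (1, -1, 1) + (-1, 1, 1) = (-1, -1, 1)`.
  obtain ⟨S, hS⟩ := exists_linearEquiv_apply_eq
    (u := ![det₃ x v w • u, det₃ u x w • v, det₃ u v x • w])
    (u' := ![-![1, 1, 1], ![1, -1, 1], ![-1, 1, 1]])
    (linearIndependent_iff_det₃_ne_zero.2 (by
      rw [det₃_smul]
      exact mul_ne_zero (mul_ne_zero (mul_ne_zero h₁ h₂) h₃) h₄))
    (linearIndependent_iff_det₃_ne_zero.2 (by
      have h4 : (2 : K) * 2 ≠ 0 := mul_ne_zero two_ne_zero two_ne_zero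
      simp only [det₃_eq, Pi.neg_apply, Matrix.cons_val_zero, Matrix.cons_val_one, Matrix.cons_val]
      convert h4 using 1
      ring))
  have hu' : det₃ x v w • S u = -![1, 1, 1] := by simpa using hS 0
  have hv' : det₃ u x w • S v = ![1, -1, 1] := by simpa using hS 1
  have hw' : det₃ u v x • S w = ![-1, 1, 1] := by simpa using hS 2
  have hx' : det₃ u v w • S x = ![-1, -1, 1] := by
    rw [← map_smul, cramer_det₃, map_add, map_add, map_smul, map_smul, map_smul, hu', hv', hw']
    ext t
    fin_cases t <;> simp
  refine ⟨S, projectivity_mk_eq (k := -(det₃ x v w)⁻¹) ?_,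
    projectivity_mk_eq (k := (det₃ u x w)⁻¹) ?_, projectivity_mk_eq (k := (det₃ u v x)⁻¹) ?_,
    projectivity_mk_eq (k := (det₃ u v w)⁻¹) ?_⟩
  · rw [neg_smul, ← smul_neg, ← hu', inv_smul_smul₀ h₁]
  · rw [← hv', inv_smul_smul₀ h₂]
  · rw [← hw', inv_smul_smul₀ h₃]
  · rw [← hx', inv_smul_smul₀ h₄]

end Normalisation

/-! ### Elimination of the remaining six points -/

section SquareRealization

variable {K : Type*} [Field K] [CharZero K] {w : Fin 10 → Fin 3 → K}

/-- Point 5 is the point at infinity of the horizontal lines, so 8 on `x = 1` and 3 on `x = -1` have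
a common height `a`, and 2 and 9 also have a common height. Point 6 lies on the diagonal and on two
further lines, and their concurrency is the quadratic equation `hF`. -/
theorem exists_of_det₃_square
    (h : ∀ i j k, i ≠ j → i ≠ k → j ≠ k →
      (det₃ (w i) (w j) (w k) = 0 ↔ ∃ t ∈ elkiesLines, i ∈ t ∧ j ∈ t ∧ k ∈ t))
    (h4 : w 4 = ![1, 1, 1]) (h0 : w 0 = ![1, -1, 1]) (h7 : w 7 = ![-1, 1, 1])
    (h1 : w 1 = ![-1, -1, 1]) :
    ∃ a y : K, (∃ k : K, w 8 = k • ![1, a, 1]) ∧ (∃ k : K, w 3 = k • ![-1, a, 1]) ∧ a ≠ 1 ∧ a ≠ -1 ∧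
      2 * y ^ 2 = -a ^ 3 + a ^ 2 + a + 1 := by
  have two : (2 : K) ≠ 0 := two_ne_zero
  have e457 := (h 4 5 7 (by decide) (by decide) (by decide)).2 (by decide)
  have e150 := (h 1 5 0 (by decide) (by decide) (by decide)).2 (by decide)
  have e480 := (h 4 8 0 (by decide) (by decide) (by decide)).2 (by decide)
  have e137 := (h 1 3 7 (by decide) (by decide) (by decide)).2 (by decide)
  have e358 := (h 3 5 8 (by decide) (by decide) (by decide)).2 (by decide)
  have e128 := (h 1 2 8 (by decide) (by decide) (by decide)).2 (by decide)
  have e390 := (h 3 9 0 (by decide) (by decide) (by decide)).2 (by decide)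
  have e259 := (h 2 5 9 (by decide) (by decide) (by decide)).2 (by decide)
  have e146 := (h 1 4 6 (by decide) (by decide) (by decide)).2 (by decide)
  have e236 := (h 2 3 6 (by decide) (by decide) (by decide)).2 (by decide)
  have e679 := (h 6 7 9 (by decide) (by decide) (by decide)).2 (by decide)
  have n := fun i j k hij hik hjk hT => mt (h i j k hij hik hjk).1 hT
  have n487 := n 4 8 7 (by decide) (by decide) (by decide) (by decide)
  have n087 := n 0 8 7 (by decide) (by decide) (by decide) (by decide)
  have n384 := n 3 8 4 (by decide) (by decide) (by decide) (by decide)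
  have n541 := n 5 4 1 (by decide) (by decide) (by decide) (by decide)
  have n240 := n 2 4 0 (by decide) (by decide) (by decide) (by decide)
  have n940 := n 9 4 0 (by decide) (by decide) (by decide) (by decide)
  have n640 := n 6 4 0 (by decide) (by decide) (by decide) (by decide)
  simp only [det₃_eq, h4, h0, h7, h1, Matrix.cons_val_zero, Matrix.cons_val_one, Matrix.cons_val]
    at e457 e150 e480 e137 e358 e128 e390 e259 e146 e236 e679 n487 n087 n384 n541 n240 n940 n640
  clear n h
  have h51 : w 5 1 = 0 := by
    apply mul_left_cancel₀ (mul_ne_zero two two)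
    linear_combination e457 - e150
  have h52 : w 5 2 = 0 := by
    apply mul_left_cancel₀ (mul_ne_zero two two)
    linear_combination -e457 - e150
  have h50 : w 5 0 ≠ 0 := by
    intro h50
    apply n541
    rw [h50, h51, h52]; ring
  have h82 : w 8 2 = w 8 0 := by
    apply mul_left_cancel₀ two
    linear_combination e480
  have h32 : w 3 2 = -w 3 0 := by
    apply mul_left_cancel₀ two
    linear_combination e137
  have h35 : w 3 1 * w 8 0 = -w 3 0 * w 8 1 := by
    apply mul_left_cancel₀ h50
    rw [h51, h52, h82, h32] at e358
    linear_combination -e358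
  have h80 : w 8 0 ≠ 0 := by
    intro h80
    rw [h82, h32, h80] at n384
    rw [h80] at h35
    exact n384 (by linear_combination 2 * h35)
  have h30 : w 3 0 ≠ 0 := by
    intro h30
    have h31 : w 3 1 = 0 := by
      apply mul_right_cancel₀ h80
      rw [h35, h30]; ring
    apply n384
    rw [h32, h31, h30]; ring
  obtain ⟨a, ha⟩ : ∃ a, w 8 1 = w 8 0 * a := ⟨w 8 1 / w 8 0, by field_simp⟩
  have h31 : w 3 1 = -w 3 0 * a := by
    apply mul_right_cancel₀ h80
    rw [h35, ha]; ring
  have ha1 : a ≠ 1 := by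
    rintro rfl
    apply n487
    rw [h82, ha]; ring
  have ha1' : a + 1 ≠ 0 := by
    intro h
    apply n087
    rw [h82, ha]
    linear_combination 2 * w 8 0 * h
  obtain ⟨l, m, h20, h22⟩ : ∃ l m, w 2 0 = m - l ∧ w 2 2 = m + l :=
    ⟨(w 2 2 - w 2 0) / 2, (w 2 2 + w 2 0) / 2, by ring, by ring⟩
  obtain ⟨l', m', h90, h92⟩ : ∃ l m, w 9 0 = l - m ∧ w 9 2 = l + m :=
    ⟨(w 9 2 + w 9 0) / 2, (w 9 2 - w 9 0) / 2, by ring, by ring⟩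
  have h21 : w 2 1 = a * m - l := by
    apply mul_left_cancel₀ (mul_ne_zero two h80)
    rw [h82, ha, h20, h22] at e128
    linear_combination -e128
  have h91 : w 9 1 = a * m' - l' := by
    apply mul_left_cancel₀ (mul_ne_zero two h30)
    rw [h32, h31, h90, h92] at e390
    linear_combination e390
  -- The heights of 2 and 9 agree and `a ≠ -1`, so `l : m = l' : m'`.
  have hlm : m * l' = m' * l := by
    apply mul_left_cancel₀ (mul_ne_zero h50 ha1')
    rw [h51, h52, h20, h21, h22, h90, h91, h92] at e259
    linear_combination -e259
  have h61 : w 6 1 = w 6 0 := by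
    apply mul_left_cancel₀ two
    linear_combination e146
  rw [h61] at e236 e679 n640
  rw [h20, h21, h22, h32, h31] at e236
  rw [h90, h91, h92] at e679
  have e236' : w 6 0 * (-(1 + a) * l - 2 * m) + w 6 2 * (2 * a * m - (a + 1) * l) = 0 := by
    apply mul_left_cancel₀ h30
    linear_combination -e236
  -- Two linear equations for the nonzero pair `(w 6 0, w 6 2)`: their determinant vanishes.
  have hR : (-(1 + a) * l - 2 * m) * (-(a - 1) * m')
      - (2 * a * m - (a + 1) * l) * (4 * l' + (1 - a) * m') = 0 := by
    by_contra hR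
    have hc : w 6 0 = 0 := by
      apply mul_right_cancel₀ hR
      linear_combination (-(a - 1) * m') * e236' - (2 * a * m - (a + 1) * l) * e679
    have hd : w 6 2 = 0 := by
      apply mul_right_cancel₀ hR
      linear_combination -(4 * l' + (1 - a) * m') * e236' + (-(1 + a) * l - 2 * m) * e679
    apply n640
    rw [hc, hd]; ring
  have hm' : m' ≠ 0 := by
    rintro rfl
    have hl' : l' ≠ 0 := by
      rintro rfl
      apply n940
      rw [h90, h91, h92]; ring
    have hm : m = 0 := by
      apply mul_right_cancel₀ hl'
      rw [hlm]; ring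
    have hl : l = 0 := by
      apply mul_left_cancel₀ (mul_ne_zero (mul_ne_zero two two) (mul_ne_zero ha1' hl'))
      rw [hm] at hR
      linear_combination hR
    apply n240
    rw [h20, h21, h22, hl, hm]; ring
  obtain ⟨x, rfl⟩ : ∃ x, l' = x * m' := ⟨l' / m', by field_simp⟩
  obtain rfl : l = x * m := by
    apply mul_left_cancel₀ hm'
    linear_combination -hlm
  have hm : m ≠ 0 := by
    rintro rfl
    apply n240
    rw [h20, h21, h22]; ring
  have hF : 2 * (a + 1) * x ^ 2 - 4 * a * x + (a ^ 2 - 1) = 0 := by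
    apply mul_left_cancel₀ (mul_ne_zero two (mul_ne_zero hm hm'))
    linear_combination hR
  -- Completing the square in `(a + 1) · hF` gives `y = (a + 1)x - a`.
  refine ⟨a, (a + 1) * x - a, ⟨w 8 0, ?_⟩, ⟨-w 3 0, ?_⟩, ha1, fun h => ha1' (by rw [h]; ring), ?_⟩
  · ext t
    fin_cases t <;> simp [ha, h82]
  · ext t
    fin_cases t <;> simp [h31, h32]
  · linear_combination (a + 1) * hF

end SquareRealization

section

variable {K : Type*} [Field K] [CharZero K]

theorem exists_normalisation {q : Fin 10 → ℙ K (Fin 3 → K)}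
    (hq : IsProjectiveRealization elkiesTriples q) :
    ∃ (S : (Fin 3 → K) ≃ₗ[K] (Fin 3 → K)) (a y : K),
      projectivity S (q 4) = affinePoint 1 1 ∧ projectivity S (q 0) = affinePoint 1 (-1) ∧
      projectivity S (q 7) = affinePoint (-1) 1 ∧ projectivity S (q 1) = affinePoint (-1) (-1) ∧
      projectivity S (q 8) = affinePoint 1 a ∧ projectivity S (q 3) = affinePoint (-1) a ∧
      a ≠ 1 ∧ a ≠ -1 ∧ evalAt elkiesCubic (-a) y = 0 := by
  have hcol : ∀ i j k, i ≠ j → i ≠ k → j ≠ k → (¬ ∃ t ∈ elkiesLines, i ∈ t ∧ j ∈ t ∧ k ∈ t) →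
      ¬ ProjectivelyCollinear {q i, q j, q k} := fun i j k hij hik hjk hT h =>
    hT ((triple_mem_elkiesTriples_iff hij hik hjk).1 ((hq.2 i j k hij hik hjk).1 h))
  obtain ⟨S, h4, h0, h7, h1⟩ := exists_projectivity_square (P₁ := q 4) (P₂ := q 0) (P₃ := q 7)
    (P₄ := q 1) (hcol 1 0 7 (by decide) (by decide) (by decide) (by decide))
    (hcol 4 1 7 (by decide) (by decide) (by decide) (by decide))
    (hcol 4 0 1 (by decide) (by decide) (by decide) (by decide))
    (hcol 4 0 7 (by decide) (by decide) (by decide) (by decide))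
  set q' := fun i => projectivity S (q i) with hq'
  let w : Fin 10 → Fin 3 → K := ![![1, -1, 1], ![-1, -1, 1], (q' 2).rep, (q' 3).rep, ![1, 1, 1],
    (q' 5).rep, (q' 6).rep, ![-1, 1, 1], (q' 8).rep, (q' 9).rep]
  have hrep : ∀ i, ∃ h : (q' i).rep ≠ 0, q' i = Projectivization.mk K (q' i).rep h := fun i =>
    ⟨(q' i).rep_nonzero, (q' i).mk_rep.symm⟩
  have hw : ∀ i, ∃ h : w i ≠ 0, q' i = Projectivization.mk K (w i) h := by
    intro i
    fin_cases i
    exacts [⟨_, h0⟩, ⟨_, h1⟩, hrep 2, hrep 3, ⟨_, h4⟩, hrep 5, hrep 6, ⟨_, h7⟩, hrep 8, hrep 9]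
  obtain ⟨a, y, ⟨k, h8⟩, ⟨k', h3⟩, ha, ha', hy⟩ := exists_of_det₃_square (w := w)
    (fun i j k hij hik hjk => ((hq.projectivity S).det₃_eq_zero_iff hw hij hik hjk).trans
      (triple_mem_elkiesTriples_iff hij hik hjk)) rfl rfl rfl rfl
  refine ⟨S, a, y, h4, h0, h7, h1, ?_, ?_, ha, ha', ?_⟩
  · obtain ⟨_, e⟩ := hw 8
    exact e.trans ((Projectivization.mk_eq_mk_iff' ..).2 ⟨k, h8.symm⟩)
  · obtain ⟨_, e⟩ := hw 3
    exact e.trans ((Projectivization.mk_eq_mk_iff' ..).2 ⟨k', h3.symm⟩)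
  · rw [evalAt_elkiesCubic]
    linear_combination hy

end

/-! ### The ten points: four collinear points, rationality and reality -/

section Configuration

/-- No four points have all their triples in the list. -/
theorem exists_notMem_elkiesTriples {S : Finset (Fin 10)} (hS : S.card = 4) :
    ∃ i ∈ S, ∃ j ∈ S, ∃ k ∈ S, i ≠ j ∧ i ≠ k ∧ j ≠ k ∧
      ({i, j, k} : Finset (Fin 10)) ∉ elkiesTriples := by
  obtain ⟨a, b, c, d, hab, hac, had, hbc, hbd, hcd, rfl⟩ := Finset.card_eq_four.1 hS
  by_contra! h
  have h1 := h a (by simp) b (by simp) c (by simp) hab hac hbc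
  have h2 := h a (by simp) b (by simp) d (by simp) hab had hbd
  have hne : ({a, b, c} : Finset (Fin 10)) ≠ {a, b, d} := fun e => by
    have : c ∈ ({a, b, d} : Finset (Fin 10)) := e ▸ by simp
    simp [hac.symm, hbc.symm, hcd] at this
  have hle := card_inter_le_one_of_mem_elkiesTriples h1 h2 hne
  have hsub : ({a, b} : Finset (Fin 10)) ⊆ {a, b, c} ∩ {a, b, d} := by
    intro x
    simp only [Finset.mem_insert, Finset.mem_singleton, Finset.mem_inter]
    tauto
  have := Finset.card_le_card hsub
  rw [Finset.card_pair hab] at this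
  omega

theorem IsAffineRealization.not_collinear {K : Type*} [Field K] {p : Fin 10 → Fin 2 → K}
    (hp : IsAffineRealization elkiesTriples p) {S : Finset (Fin 10)} (hS : S.card = 4) :
    ¬ Collinear K (p '' (S : Set (Fin 10))) := by
  intro h
  obtain ⟨i, hi, j, hj, k, hk, hij, hik, hjk, hT⟩ := exists_notMem_elkiesTriples hS
  refine hT ((hp.2 i j k hij hik hjk).1 (h.subset ?_))
  rintro _ (rfl | rfl | rfl)
  exacts [⟨i, hi, rfl⟩, ⟨j, hj, rfl⟩, ⟨k, hk, rfl⟩]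

theorem IsProjectiveRealization.not_projectivelyCollinear {K : Type*} [Field K]
    {q : Fin 10 → ℙ K (Fin 3 → K)} (hq : IsProjectiveRealization elkiesTriples q)
    {S : Finset (Fin 10)} (hS : S.card = 4) :
    ¬ ProjectivelyCollinear (q '' (S : Set (Fin 10))) := by
  rintro ⟨ℓ, h⟩
  obtain ⟨i, hi, j, hj, k, hk, hij, hik, hjk, hT⟩ := exists_notMem_elkiesTriples hS
  refine hT ((hq.2 i j k hij hik hjk).1 ⟨ℓ, ?_⟩)
  rintro _ (rfl | rfl | rfl)
  exacts [h _ ⟨i, hi, rfl⟩, h _ ⟨j, hj, rfl⟩, h _ ⟨k, hk, rfl⟩]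

theorem not_isProjectiveRealization_rat (q : Fin 10 → ℙ ℚ (Fin 3 → ℚ)) :
    ¬ IsProjectiveRealization elkiesTriples q := by
  intro hq
  obtain ⟨S, a, y, -, -, -, -, -, -, ha, ha', h⟩ := exists_normalisation hq
  rw [evalAt_elkiesCubic, sub_eq_zero] at h
  rcases ((rational_points_elkiesCubic _ _).1 h).1 with h | h
  · exact ha' (by linear_combination -h)
  · exact ha (by linear_combination -h)

/-- Collinearity is the vanishing of a determinant, so rational coordinates would give a realization
over `ℚ`. -/
theorem IsProjectiveRealization.exists_not_isRationalPoint {q : Fin 10 → ℙ ℝ (Fin 3 → ℝ)}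
    (hq : IsProjectiveRealization elkiesTriples q) : ∃ i, ¬ IsRationalPoint (q i) := by
  by_contra! h
  choose v hv e using h
  have hv' : ∀ i, v i ≠ 0 := fun i h => hv i (by ext t; simp [h])
  refine not_isProjectiveRealization_rat (fun i => Projectivization.mk ℚ (v i) (hv' i))
    ⟨fun i j hij => hq.1 ?_, fun i j k hij hik hjk => ?_⟩
  · obtain ⟨c, hc⟩ := (Projectivization.mk_eq_mk_iff' ..).1 hij
    rw [e, e, Projectivization.mk_eq_mk_iff']
    refine ⟨c, ?_⟩
    ext t
    simp [← hc]
  · rw [projectivelyCollinear_iff, ← hq.det₃_eq_zero_iff (fun i => ⟨hv i, e i⟩) hij hik hjk]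
    have := map_det₃ (Rat.castHom ℝ) (v i) (v j) (v k)
    simp only [Rat.coe_castHom] at this
    rw [← this, Rat.cast_eq_zero]

theorem IsAffineRealization.exists_irrational {p : Fin 10 → Fin 2 → ℝ}
    (hp : IsAffineRealization elkiesTriples p) : ∃ i t, Irrational (p i t) := by
  by_contra! h
  obtain ⟨i, hi⟩ := hp.projective.exists_not_isRationalPoint
  obtain ⟨x, hx⟩ := not_not.1 (h i 0)
  obtain ⟨y, hy⟩ := not_not.1 (h i 1)
  have e : (fun t => ((![x, y, 1] : Fin 3 → ℚ) t : ℝ)) = ![p i 0, p i 1, 1] := by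
    ext t
    fin_cases t <;> simp [hx, hy]
  refine hi ⟨![x, y, 1], ?_, ?_⟩
  · rw [e]; exact fun h => one_ne_zero (congrFun h 2)
  · rw [affinePoint]; congr 1; exact e.symm

/-- Homogeneous coordinates of a realization over `ℤ[√2]`. -/
def elkiesPoints : Fin 10 → Fin 3 → ℤ√2 :=
  -- The square normalisation with `a = 0`, where the cubic gives `y² = 1/2`, followed by `(X, Y, Z)
  -- ↦ (X, Y, X + 2Z)`, which makes point 5 finite.
  ![![1, -1, 3], ![-1, -1, 1], ![⟨-1, 1⟩, -1, ⟨1, 3⟩], ![-1, 0, 1], ![1, 1, 3], ![1, 0, 1],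
    ![1, 1, ⟨-1, -4⟩], ![-1, 1, 1], ![1, 0, 3], ![⟨1, -1⟩, -1, ⟨3, 1⟩]]

theorem elkiesPoints_two_ne_zero : ∀ i, elkiesPoints i 2 ≠ 0 := by
  decide

theorem det₃_elkiesPoints {i j k : Fin 10} (hij : i ≠ j) (hik : i ≠ k) (hjk : j ≠ k) :
    det₃ (elkiesPoints i) (elkiesPoints j) (elkiesPoints k) = 0 ↔
      ({i, j, k} : Finset (Fin 10)) ∈ elkiesTriples := by
  rw [triple_mem_elkiesTriples_iff hij hik hjk, det₃_eq]
  revert i j k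
  decide +kernel

/-- Yields injectivity of the realization: if two labels had the same image, every triple containing
both would be collinear. -/
theorem exists_third_notMem_elkiesTriples {i j : Fin 10} (hij : i ≠ j) :
    ∃ k, i ≠ k ∧ j ≠ k ∧ ({i, j, k} : Finset (Fin 10)) ∉ elkiesTriples := by
  have h : ∀ i j : Fin 10, i ≠ j → ∃ k, i ≠ k ∧ j ≠ k ∧
      ¬ ∃ t ∈ elkiesLines, i ∈ t ∧ j ∈ t ∧ k ∈ t := by
    decide +kernel
  obtain ⟨k, hik, hjk, hk⟩ := h i j hij
  exact ⟨k, hik, hjk, mt (triple_mem_elkiesTriples_iff hij hik hjk).1 hk⟩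

theorem exists_isAffineRealization_real :
    ∃ p : Fin 10 → Fin 2 → ℝ, IsAffineRealization elkiesTriples p := by
  let φ : ℤ√2 →+* ℝ := Zsqrtd.toReal zero_le_two
  have hφ : Function.Injective φ := Zsqrtd.toReal_injective zero_le_two fun n h => by
    have h1 : -2 < n := by nlinarith
    have h2 : n < 2 := by nlinarith
    interval_cases n <;> omega
  let z : Fin 10 → ℝ := fun i => φ (elkiesPoints i 2)
  have hz : ∀ i, z i ≠ 0 := fun i => (map_ne_zero_iff φ hφ).2 (elkiesPoints_two_ne_zero i)
  let p : Fin 10 → Fin 2 → ℝ := fun i => ![φ (elkiesPoints i 0) / z i, φ (elkiesPoints i 1) / z i]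
  have hp : ∀ i, ![p i 0, p i 1, 1] = (z i)⁻¹ • fun t => φ (elkiesPoints i t) := by
    intro i
    ext t
    fin_cases t <;> simp [p, z, div_eq_inv_mul]
    exact (inv_mul_cancel₀ (hz i)).symm
  have key : ∀ i j k, i ≠ j → i ≠ k → j ≠ k →
      (Collinear ℝ ({p i, p j, p k} : Set (Fin 2 → ℝ)) ↔
        ({i, j, k} : Finset (Fin 10)) ∈ elkiesTriples) := by
    intro i j k hij hik hjk
    rw [collinear_iff_det₃_eq_zero, hp, hp, hp, det₃_smul, ← map_det₃ φ, mul_eq_zero,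
      or_iff_right (mul_ne_zero (mul_ne_zero (inv_ne_zero (hz i)) (inv_ne_zero (hz j)))
        (inv_ne_zero (hz k))), map_eq_zero_iff φ hφ, det₃_elkiesPoints hij hik hjk]
  refine ⟨p, fun i j hij => ?_, key⟩
  by_contra hne
  obtain ⟨k, hik, hjk, hk⟩ := exists_third_notMem_elkiesTriples hne
  refine hk ((key i j k hne hik hjk).1 ?_)
  rw [hij, Set.insert_eq_of_mem (Set.mem_insert _ _)]
  exact collinear_pair ℝ _ _

end Configuration

theorem mainTheorem3 :
    -- eleven triples of points, two of which never share two points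
    (elkiesTriples.card = 11 ∧ (∀ S ∈ elkiesTriples, S.card = 3) ∧
      ∀ S ∈ elkiesTriples, ∀ S' ∈ elkiesTriples, S ≠ S' → (S ∩ S').card ≤ 1) ∧
    -- no four points are collinear in a realization
    (∀ p : Fin 10 → Fin 2 → ℝ, IsAffineRealization elkiesTriples p →
      ∀ S : Finset (Fin 10), S.card = 4 → ¬ Collinear ℝ (p '' (S : Set (Fin 10)))) ∧
    (∀ q : Fin 10 → ℙ ℝ (Fin 3 → ℝ), IsProjectiveRealization elkiesTriples q →
      ∀ S : Finset (Fin 10), S.card = 4 → ¬ ProjectivelyCollinear (q '' (S : Set (Fin 10)))) ∧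
    -- there is a real realization
    (∃ p : Fin 10 → Fin 2 → ℝ, IsAffineRealization elkiesTriples p) ∧
    -- every real realization has an irrational point, in the affine and in the projective plane
    (∀ p : Fin 10 → Fin 2 → ℝ, IsAffineRealization elkiesTriples p →
      ∃ i t, Irrational (p i t)) ∧
    (∀ q : Fin 10 → ℙ ℝ (Fin 3 → ℝ), IsProjectiveRealization elkiesTriples q →
      ∃ i, ¬ IsRationalPoint (q i)) ∧
    -- normalisation: a realization over `K` gives a `K`-point `(-a, y)` of the cubic
    (∀ (K : Type*) [Field K] [CharZero K] (q : Fin 10 → ℙ K (Fin 3 → K)),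
      IsProjectiveRealization elkiesTriples q →
      ∃ (S : (Fin 3 → K) ≃ₗ[K] (Fin 3 → K)) (a y : K),
        projectivity S (q 4) = affinePoint 1 1 ∧
        projectivity S (q 0) = affinePoint 1 (-1) ∧
        projectivity S (q 7) = affinePoint (-1) 1 ∧
        projectivity S (q 1) = affinePoint (-1) (-1) ∧
        projectivity S (q 8) = affinePoint 1 a ∧
        projectivity S (q 3) = affinePoint (-1) a ∧
        a ≠ 1 ∧ a ≠ -1 ∧
        evalAt elkiesCubic (-a) y = 0) ∧
    -- the rational points of the cubic
    (∀ x y : ℚ, 2 * y ^ 2 = x ^ 3 + x ^ 2 - x + 1 ↔ (x = 1 ∨ x = -1) ∧ (y = 1 ∨ y = -1)) ∧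
    -- the cubic is birational to `y² + y = x³ - x²`, a model of `X₁(11)`, and the rational points
    -- of this model
    BirationallyEquivalent elkiesCubic weierstrassCubic ∧
    IsModelOfX1 11 weierstrassCubic ∧
    (∀ x y : ℚ, y ^ 2 + y = x ^ 3 - x ^ 2 ↔ (x = 0 ∨ x = 1) ∧ (y = 0 ∨ y = -1)) := by
  refine ⟨⟨card_elkiesTriples, fun _ => card_eq_three_of_mem_elkiesTriples,
      fun _ hS _ hS' => card_inter_le_one_of_mem_elkiesTriples hS hS'⟩,
    fun p hp S hS => hp.not_collinear hS, fun q hq S hS => hq.not_projectivelyCollinear hS,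
    exists_isAffineRealization_real, fun p hp => hp.exists_irrational,
    fun q hq => hq.exists_not_isRationalPoint, fun K _ _ q hq => exists_normalisation hq,
    rational_points_elkiesCubic, birationallyEquivalent_elkiesCubic_weierstrassCubic,
    isModelOfX1_weierstrassCubic, rational_points_weierstrassCubic⟩
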